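/- Let $\Omega\subset\mathbb C$ be open and connected, let $a,b$ be analytic in $\Omega$, and assume that $\Omega_+=\{z\in\Omega: |b(z)|<|a(z)|\}$ and $\Omega_-=\{z\in\Omega: |b(z)|>|a(z)|\}$ are both nonempty. Put $\rho(z,w)=a(z)\overline{a(w)}-b(z)\overline{b(w)}$. Let $\mathcal C$ and $\mathcal D$ be complex Pontryagin spaces (with forms $[\cdot,\cdot]_{\mathcal C}$, $[\cdot,\cdot]_{\mathcal D}$) having the same finite index of negativity, and let $S$ be a function, analytic in an open set $U\subset\Omega_+$, whose values are continuous linear operators from $\mathcal D$ to $\mathcal C$. Assume that $S$ is a generalized Schur function, i.e. that the kernel $$K_S(z,w)=\frac{I_{\mathcal C}-S(z)S(w)^*}{\rho(z,w)},\qquad z,w\in U,$$ (the adjoint being taken with respect to the indefinite forms) has a finite number of negative squares in $U$. Let $\mathcal P(S)$ be the reproducing kernel Pontryagin space of $\mathcal C$-valued functions on $U$ with reproducing kernel $K_S$, and let $\alpha\in U$. For $f\in\mathcal P(S)$ set $$(R(a,b,\alpha)f)(z)=\frac{a(z)f(z)-a(\alpha)f(\alpha)}{a(\alpha)b(z)-b(\alpha)a(z)},\qquad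 z\in U,$$ where at the points $z$ at which the denominator vanishes the value is the limit of the quotient, and let $R(b,a,\alpha)$ be the operator obtained by exchanging $a$ and $b$. Then $R(a,b,\alpha)$ and $R(b,a,\alpha)$ map $\mathcal P(S)$ into itself, and $$[R(a,b,\alpha)f,R(a,b,\alpha)f]_{\mathcal P(S)}-[R(b,a,\alpha)f,R(b,a,\alpha)f]_{\mathcal P(S)}+[f(\alpha),f(\alpha)]_{\mathcal C}\le 0\qquad\text{for all } f\in\mathcal P(S).$$ -/

import Mathlib

open Filter Topology

noncomputable section

/-- A sesquilinear form `[x, y]`, linear in `x` and conjugate-linear in `y`. -/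
abbrev SesqForm (V : Type*) [AddCommGroup V] [Module ℂ V] : Type _ :=
  V →ₗ[ℂ] V →ₗ⋆[ℂ] ℂ

section Pontryagin

variable {V : Type*} [AddCommGroup V] [Module ℂ V]

/-- The form is Hermitian: `[y, x]` is the complex conjugate of `[x, y]`. -/
def IsHermitianForm (B : SesqForm V) : Prop :=
  ∀ x y : V, B y x = starRingEnd ℂ (B x y)

/-- `V = Vp [+] Vm` is a fundamental decomposition: a direct and orthogonal sum in which
`(Vp, [·,·])` is a Hilbert space and `(Vm, -[·,·])` is a finite-dimensional Hilbert space
(for which completeness is automatic). -/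
structure IsFundamentalDecomposition (B : SesqForm V) (Vp Vm : Submodule ℂ V) : Prop where
  isCompl : IsCompl Vp Vm
  orthogonal : ∀ p ∈ Vp, ∀ m ∈ Vm, B p m = 0
  pos : ∀ p ∈ Vp, p ≠ 0 → 0 < (B p p).re
  neg : ∀ m ∈ Vm, m ≠ 0 → (B m m).re < 0
  finiteDimensional : FiniteDimensional ℂ Vm
  complete : ∀ u : ℕ → V, (∀ n, u n ∈ Vp) →
    (∀ ε > 0, ∃ N, ∀ i ≥ N, ∀ j ≥ N, (B (u i - u j) (u i - u j)).re < ε) →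
    ∃ x ∈ Vp, Tendsto (fun n => (B (u n - x) (u n - x)).re) atTop (𝓝 0)

/-- `(V, [·,·])` is a Pontryagin space. -/
def IsPontryagin (B : SesqForm V) : Prop :=
  IsHermitianForm B ∧ ∃ Vp Vm : Submodule ℂ V, IsFundamentalDecomposition B Vp Vm

end Pontryagin

/-- `(V, [·,·])` is a Pontryagin space with index of negativity `k`, and the norm carried by `V`
induces the topology of that Pontryagin space, i.e. it is equivalent to the Hilbert norm
`([v₊, v₊] - [v₋, v₋])^(1/2)` of a fundamental decomposition. -/
def IsTopPontryagin {V : Type*} [NormedAddCommGroup V] [NormedSpace ℂ V]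
    (B : SesqForm V) (k : ℕ) : Prop :=
  IsHermitianForm B ∧ ∃ Vp Vm : Submodule ℂ V,
    IsFundamentalDecomposition B Vp Vm ∧ Module.finrank ℂ Vm = k ∧
    ∃ c₁ > (0 : ℝ), ∃ c₂ > (0 : ℝ), ∀ p ∈ Vp, ∀ m ∈ Vm,
      c₁ * ‖p + m‖ ^ 2 ≤ (B p p).re - (B m m).re ∧
      (B p p).re - (B m m).re ≤ c₂ * ‖p + m‖ ^ 2

open Classical in
/-- The adjoint `T*` of a continuous operator between Pontryagin spaces, determined by
`[T d, c]_C = [d, T* c]_D`. (Such an operator exists and is unique for Pontryagin spaces; the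
value `0` is a placeholder used only for forms that admit no adjoint.) -/
def pontryaginAdjoint {C D : Type*} [NormedAddCommGroup C] [NormedSpace ℂ C]
    [NormedAddCommGroup D] [NormedSpace ℂ D] (BC : SesqForm C) (BD : SesqForm D)
    (T : D →L[ℂ] C) : C →L[ℂ] D :=
  if h : ∃ T' : C →L[ℂ] D, ∀ d c, BC (T d) c = BD d (T' c) then h.choose else 0

section Kernels

variable {X C : Type*} [NormedAddCommGroup C] [NormedSpace ℂ C]

/-- The matrix with `(ℓ, k)` entry `[K(w_ℓ, w_k) c_k, c_ℓ]`. -/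
def kernelMatrix (BC : SesqForm C) (K : X → X → C →L[ℂ] C) {N : ℕ}
    (w : Fin N → X) (c : Fin N → C) : Matrix (Fin N) (Fin N) ℂ :=
  Matrix.of fun l k => BC (K (w l) (w k) (c k)) (c l)

/-- The kernel `K` has `κ` negative squares. Eigenvalues are counted with multiplicity. -/
structure HasNegativeSquares (BC : SesqForm C) (K : X → X → C →L[ℂ] C) (κ : ℕ) : Prop where
  /-- `K(z, w) = K(w, z)*` -/
  hermitian : ∀ z w c d, BC (K z w c) d = BC c (K w z d)
  le : ∀ (N : ℕ) (w : Fin N → X) (c : Fin N → C),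
    ∃ h : (kernelMatrix BC K w c).IsHermitian, Nat.card {i // h.eigenvalues i < 0} ≤ κ
  exists_eq : ∃ (N : ℕ) (w : Fin N → X) (c : Fin N → C),
    ∃ h : (kernelMatrix BC K w c).IsHermitian, Nat.card {i // h.eigenvalues i < 0} = κ

/-- The space `P` of `C`-valued functions on `X`, with the form `[·,·]_P`, is the reproducing
kernel Pontryagin space with reproducing kernel `K`: it is a Pontryagin space, it contains the
functions `K(·, w) c`, and `[f, K(·, w) c]_P = [f(w), c]_C`. -/
structure IsReproducingKernelPontryagin (BC : SesqForm C) (K : X → X → C →L[ℂ] C)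
    (P : Submodule ℂ (X → C)) (BP : SesqForm P) : Prop where
  pontryagin : IsPontryagin BP
  kernel_mem : ∀ (w : X) (c : C), (fun z => K z w c) ∈ P
  reproducing : ∀ (f : P) (w : X) (c : C),
    BP f ⟨fun z => K z w c, kernel_mem w c⟩ = BC ((f : X → C) w) c

end Kernels

/-- `Ω₊ = {z ∈ Ω : |b(z)| < |a(z)|}` -/
def omegaPlus (Ω : Set ℂ) (a b : ℂ → ℂ) : Set ℂ := {z ∈ Ω | ‖b z‖ < ‖a z‖}

/-- `Ω₋ = {z ∈ Ω : |b(z)| > |a(z)|}` -/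
def omegaMinus (Ω : Set ℂ) (a b : ℂ → ℂ) : Set ℂ := {z ∈ Ω | ‖a z‖ < ‖b z‖}

/-- `ρ(z, w) = a(z) conj(a(w)) - b(z) conj(b(w))` -/
def rhoKernel (a b : ℂ → ℂ) (z w : ℂ) : ℂ :=
  a z * starRingEnd ℂ (a w) - b z * starRingEnd ℂ (b w)

section Schur

variable {C D : Type*} [NormedAddCommGroup C] [NormedSpace ℂ C]
  [NormedAddCommGroup D] [NormedSpace ℂ D]

/-- The kernel `K_S(z, w) = (I - S(z) S(w)*) / ρ(z, w)` on the set `U`. -/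
def schurKernel (BC : SesqForm C) (BD : SesqForm D) (a b : ℂ → ℂ) (U : Set ℂ)
    (S : ℂ → D →L[ℂ] C) (z w : U) : C →L[ℂ] C :=
  (rhoKernel a b z w)⁻¹ •
    (ContinuousLinearMap.id ℂ C - (S z).comp (pontryaginAdjoint BC BD (S w)))

/-- `S` is a generalized Schur function on the open set `U`: it is analytic there, and `K_S` has
a finite number of negative squares there. -/
def IsGeneralizedSchur (BC : SesqForm C) (BD : SesqForm D) (a b : ℂ → ℂ) (U : Set ℂ)
    (S : ℂ → D →L[ℂ] C) : Prop :=
  AnalyticOnNhd ℂ S U ∧ ∃ κ : ℕ, HasNegativeSquares BC (schurKernel BC BD a b U S) κ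

/-- The quotient `(a(z) f(z) - a(α) f(α)) / (a(α) b(z) - b(α) a(z))`. -/
def resolventQuotient (a b : ℂ → ℂ) {U : Set ℂ} (α : U) (f : U → C) (z : U) : C :=
  (a α * b z - b α * a z)⁻¹ • (a z • f z - a α • f α)

open Classical in
/-- The resolvent-like operator `R(a, b, α)`. At the points where the denominator vanishes
(among them `z = α`) its value is the limit of the quotient. -/
def resolventLike (a b : ℂ → ℂ) {U : Set ℂ} (α : U) (f : U → C) (z : U) : C :=
  if a α * b z - b α * a z = 0 then limUnder (𝓝[≠] z) (resolventQuotient a b α f)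
  else resolventQuotient a b α f z

end Schur

end

/-! ### Hermitian forms and orthogonal companions -/

section SesquilinearForms

variable {V : Type*} [AddCommGroup V] [Module ℂ V] {B : SesqForm V}

/-! Put ρ = |a(α)|² - |b(α)|² > 0 and rotate (a, b) hyperbolically to A = (conj(a(α)) a - conj(b(α))
b)/√ρ and β = (a(α) b - b(α) a)/√ρ. This keeps ρ(z, w) and gives β(α) = 0, A(α) = √ρ. It then
suffices to treat the generalized backward shift g = (A f - A(α) f(α))/β, and to show that g lies in
P(S) with [g, g] + ρ [f(α), f(α)] ≤ [f, f] (`exists_backward_shift`). Indeed R(a,b,α)f = (a(α) g +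
conj(b(α)) f)/ρ and R(b,a,α)f = -(b(α) g + conj(a(α)) f)/ρ; in the difference of their squares the
cross terms cancel, leaving ([g, g] - [f, f])/ρ.

For the shift, the kernel identity says that the pairs ((conj(β(w)) K_w c, c), (conj(A(w)) K_w c,
S(w)* c)) span an isometric relation from P ⊕ C to P ⊕ D. These sums have equal negative index, and
the domain is dense because elements of P are continuous and β is nonzero on a dense set. The
adjoint of such a relation is an everywhere defined contraction
(`exists_adjoint_of_isometric_relation`); applied to (f, 0) it yields (g, A(α) f(α)).

Both the adjoint theorem and continuity (`IsFundamentalDecomposition.continuous_of_reproducing`)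
rest on `IsFundamentalDecomposition.exists_neg_le`: the negative part of a fundamental decomposition
can be chosen inside a given dense subspace, where its finitely many dimensions are handled exactly
and Hilbert space estimates suffice for the rest. -/

theorem IsHermitianForm.eq_zero_symm (hB : IsHermitianForm B) {x y : V} (h : B x y = 0) :
    B y x = 0 := by
  rw [hB x y, h, map_zero]

theorem IsHermitianForm.re_symm (hB : IsHermitianForm B) (x y : V) :
    (B y x).re = (B x y).re := by
  rw [hB x y, Complex.conj_re]

theorem IsHermitianForm.re_add_self (hB : IsHermitianForm B) (x y : V) :
    (B (x + y) (x + y)).re = (B x x).re + 2 * (B x y).re + (B y y).re := by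
  simp only [map_add, LinearMap.add_apply, Complex.add_re, hB.re_symm x y]
  ring

theorem re_smul_self (B : SesqForm V) (c : ℂ) (x : V) :
    (B (c • x) (c • x)).re = ‖c‖ ^ 2 * (B x x).re := by
  simp only [map_smul, LinearMap.smul_apply, map_smulₛₗ, smul_eq_mul, ← mul_assoc]
  rw [Complex.conj_mul', ← Complex.ofReal_pow, Complex.re_ofReal_mul]

/-- The Cauchy-Schwarz inequality on a subspace on which the form is nonnegative. -/
theorem IsHermitianForm.norm_sq_le_of_nonneg (hB : IsHermitianForm B) (W : Submodule ℂ V)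
    (hW : ∀ x ∈ W, 0 ≤ (B x x).re) {x y : V} (hx : x ∈ W) (hy : y ∈ W) :
    ‖B x y‖ ^ 2 ≤ (B x x).re * (B y y).re := by
  let core : PreInnerProductSpace.Core ℂ W :=
    { inner := fun u v => B v u
      conj_inner_symm := fun u v => (hB u v).symm
      re_inner_nonneg := fun u => hW u u.2
      add_left := fun u v w => by simp
      smul_left := fun u v r => by simp }
  have h := @InnerProductSpace.Core.inner_mul_inner_self_le ℂ W _ _ _ core ⟨x, hx⟩ ⟨y, hy⟩
  change ‖B y x‖ * ‖B x y‖ ≤ (B x x).re * (B y y).re at h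
  rw [hB x y, RCLike.norm_conj] at h
  rwa [sq]

/-- The orthogonal companion of a subspace. -/
def formOrthogonal (B : SesqForm V) (N : Submodule ℂ V) : Submodule ℂ V where
  carrier := {x | ∀ y ∈ N, B x y = 0}
  add_mem' := fun hx hy z hz => by simp [hx z hz, hy z hz]
  zero_mem' := fun z _ => by simp
  smul_mem' := fun c x hx z hz => by simp [hx z hz]

/-- Nondegeneracy on N makes pairing with a basis of N injective on N, hence onto by equality of
dimensions; some y in N therefore has the same pairings as x. -/
theorem exists_sub_mem_formOrthogonal (N : Submodule ℂ V) [FiniteDimensional ℂ N]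
    (hN : ∀ y ∈ N, (∀ z ∈ N, B y z = 0) → y = 0) (x : V) :
    ∃ y ∈ N, x - y ∈ formOrthogonal B N := by
  let e := Module.finBasis ℂ N
  let Φ : V →ₗ[ℂ] (Fin (Module.finrank ℂ N) → ℂ) :=
    { toFun := fun v i => B v (e i)
      map_add' := fun v w => by ext i; simp
      map_smul' := fun c v => by ext i; simp }
  have key : ∀ v : V, Φ v = 0 → v ∈ formOrthogonal B N := by
    intro v hv z hz
    have hz' := e.sum_repr ⟨z, hz⟩
    have : z = ∑ i, e.repr ⟨z, hz⟩ i • (e i : V) := by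
      have := congrArg (Submodule.subtype N) hz'
      rw [map_sum] at this
      exact this.symm
    rw [this, map_sum]
    refine Finset.sum_eq_zero fun i _ => ?_
    have hi : B v (e i) = 0 := congrFun hv i
    simp [hi]
  have hinj : Function.Injective (Φ.comp N.subtype) := by
    rw [injective_iff_map_eq_zero]
    intro y hy
    exact Subtype.ext (hN y y.2 (key y hy))
  have hsurj : Function.Surjective (Φ.comp N.subtype) :=
    (LinearMap.injective_iff_surjective_of_finrank_eq_finrank (by simp)).1 hinj
  obtain ⟨y, hy⟩ := hsurj (Φ x)
  refine ⟨y, y.2, key _ ?_⟩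
  rw [map_sub, sub_eq_zero]
  exact hy.symm

end SesquilinearForms

/-! ### The Hilbert space attached to a fundamental decomposition -/

namespace IsFundamentalDecomposition

variable {V : Type*} [AddCommGroup V] [Module ℂ V] {B : SesqForm V} {Vp Vm : Submodule ℂ V}

/-- The projection onto the positive subspace. -/
noncomputable def posPart (h : IsFundamentalDecomposition B Vp Vm) : V →ₗ[ℂ] V :=
  Vp.projection Vm h.isCompl

/-- The projection onto the negative subspace. -/
noncomputable def negPart (h : IsFundamentalDecomposition B Vp Vm) : V →ₗ[ℂ] V :=
  Vm.projection Vp h.isCompl.symm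

/-- The fundamental symmetry. -/
noncomputable def symmetry (h : IsFundamentalDecomposition B Vp Vm) : V →ₗ[ℂ] V :=
  h.posPart - h.negPart

variable (h : IsFundamentalDecomposition B Vp Vm)
include h

theorem posPart_mem (x : V) : h.posPart x ∈ Vp := Submodule.projection_apply_mem _ _

theorem negPart_mem (x : V) : h.negPart x ∈ Vm := Submodule.projection_apply_mem _ _

theorem posPart_of_mem {x : V} (hx : x ∈ Vp) : h.posPart x = x :=
  Submodule.projection_apply_of_mem_left _ hx

theorem negPart_of_mem {x : V} (hx : x ∈ Vm) : h.negPart x = x :=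
  Submodule.projection_apply_of_mem_left _ hx

theorem posPart_of_mem_neg {x : V} (hx : x ∈ Vm) : h.posPart x = 0 :=
  Submodule.projection_apply_of_mem_right _ hx

theorem negPart_of_mem_pos {x : V} (hx : x ∈ Vp) : h.negPart x = 0 :=
  Submodule.projection_apply_of_mem_right _ hx

theorem posPart_add_negPart (x : V) : h.posPart x + h.negPart x = x := by
  obtain ⟨p, hp, m, hm, rfl⟩ := Submodule.mem_sup.1
    (show x ∈ Vp ⊔ Vm from h.isCompl.sup_eq_top ▸ Submodule.mem_top)
  rw [map_add, map_add, h.posPart_of_mem hp, h.posPart_of_mem_neg hm, h.negPart_of_mem hm,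
    h.negPart_of_mem_pos hp, add_zero, zero_add]

theorem symmetry_apply (x : V) : h.symmetry x = h.posPart x - h.negPart x := rfl

theorem symmetry_symmetry (x : V) : h.symmetry (h.symmetry x) = x := by
  rw [symmetry_apply, symmetry_apply, map_sub, map_sub, h.posPart_of_mem (h.posPart_mem x),
    h.posPart_of_mem_neg (h.negPart_mem x), h.negPart_of_mem (h.negPart_mem x),
    h.negPart_of_mem_pos (h.posPart_mem x), sub_zero, zero_sub, sub_neg_eq_add,
    h.posPart_add_negPart]

theorem symmetry_of_mem_pos {x : V} (hx : x ∈ Vp) : h.symmetry x = x := by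
  rw [symmetry_apply, h.posPart_of_mem hx, h.negPart_of_mem_pos hx, sub_zero]

theorem symmetry_of_mem_neg {x : V} (hx : x ∈ Vm) : h.symmetry x = -x := by
  rw [symmetry_apply, h.posPart_of_mem_neg hx, h.negPart_of_mem hx, zero_sub]

variable (hB : IsHermitianForm B)
include hB

theorem apply_eq (x y : V) :
    B x y = B (h.posPart x) (h.posPart y) + B (h.negPart x) (h.negPart y) := by
  conv_lhs => rw [← h.posPart_add_negPart x, ← h.posPart_add_negPart y]
  simp only [map_add, LinearMap.add_apply]
  rw [h.orthogonal _ (h.posPart_mem x) _ (h.negPart_mem y),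
    hB.eq_zero_symm (h.orthogonal _ (h.posPart_mem y) _ (h.negPart_mem x))]
  ring

theorem apply_symmetry (x y : V) :
    B x (h.symmetry y) = B (h.posPart x) (h.posPart y) - B (h.negPart x) (h.negPart y) := by
  rw [symmetry_apply, map_sub, h.apply_eq hB x, h.apply_eq hB x,
    h.posPart_of_mem (h.posPart_mem y),
    h.posPart_of_mem_neg (h.negPart_mem y), h.negPart_of_mem (h.negPart_mem y),
    h.negPart_of_mem_pos (h.posPart_mem y)]
  simp

theorem symmetry_apply_left (x y : V) : B (h.symmetry x) y = B x (h.symmetry y) := by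
  rw [hB y, h.apply_symmetry hB, h.apply_symmetry hB, map_sub, ← hB, ← hB]

omit hB in
theorem re_posPart_nonneg (x : V) : 0 ≤ (B (h.posPart x) (h.posPart x)).re := by
  rcases eq_or_ne (h.posPart x) 0 with h0 | h0
  · simp [h0]
  · exact (h.pos _ (h.posPart_mem x) h0).le

omit hB in
theorem re_negPart_nonpos (x : V) : (B (h.negPart x) (h.negPart x)).re ≤ 0 := by
  rcases eq_or_ne (h.negPart x) 0 with h0 | h0
  · simp [h0]
  · exact (h.neg _ (h.negPart_mem x) h0).le

theorem re_symmetry_nonneg (x : V) : 0 ≤ (B x (h.symmetry x)).re := by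
  rw [h.apply_symmetry hB, Complex.sub_re]
  linarith [h.re_posPart_nonneg x, h.re_negPart_nonpos x]

theorem eq_zero_of_re_symmetry {x : V} (hx : (B x (h.symmetry x)).re = 0) : x = 0 := by
  rw [h.apply_symmetry hB, Complex.sub_re] at hx
  have hp : h.posPart x = 0 := by
    by_contra h0
    linarith [h.pos _ (h.posPart_mem x) h0, h.re_negPart_nonpos x]
  have hm : h.negPart x = 0 := by
    by_contra h0
    linarith [h.neg _ (h.negPart_mem x) h0, h.re_posPart_nonneg x]
  rw [← h.posPart_add_negPart x, hp, hm, add_zero]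

theorem re_apply_le (x : V) : (B x x).re ≤ (B x (h.symmetry x)).re := by
  rw [h.apply_symmetry hB, h.apply_eq hB, Complex.sub_re, Complex.add_re]
  linarith [h.re_negPart_nonpos x]

/-- The Hilbert space inner product of a fundamental decomposition. -/
@[reducible] noncomputable def core : InnerProductSpace.Core ℂ V where
  inner x y := B y (h.symmetry x)
  conj_inner_symm x y := by rw [← h.symmetry_apply_left hB, hB y]; simp
  re_inner_nonneg x := h.re_symmetry_nonneg hB x
  add_left x y z := by simp
  smul_left x y r := by simp
  definite x hx := h.eq_zero_of_re_symmetry hB (by rw [hx]; rfl)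

/-- The Hilbert space norm of a fundamental decomposition. -/
@[reducible] noncomputable def normedAddCommGroup : NormedAddCommGroup V :=
  (h.core hB).toNormedAddCommGroup

/-- The Hilbert space structure of a fundamental decomposition. -/
@[reducible] noncomputable def innerProductSpace :
    letI := h.normedAddCommGroup hB
    InnerProductSpace ℂ V :=
  letI := h.core hB
  InnerProductSpace.ofCore (h.core hB).toCore

theorem inner_eq (x y : V) :
    letI := h.normedAddCommGroup hB
    letI := h.innerProductSpace hB
    inner ℂ x y = B y (h.symmetry x) := rfl

theorem norm_sq_eq (x : V) :
    letI := h.normedAddCommGroup hB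
    ‖x‖ ^ 2 = (B x (h.symmetry x)).re := by
  let := h.normedAddCommGroup hB
  let := h.innerProductSpace hB
  rw [@norm_sq_eq_re_inner ℂ]
  rfl

theorem norm_sq_eq_of_mem_pos {x : V} (hx : x ∈ Vp) :
    letI := h.normedAddCommGroup hB
    ‖x‖ ^ 2 = (B x x).re := by
  rw [h.norm_sq_eq hB, h.symmetry_of_mem_pos hx]

theorem norm_sq_eq_of_mem_neg {x : V} (hx : x ∈ Vm) :
    letI := h.normedAddCommGroup hB
    ‖x‖ ^ 2 = -(B x x).re := by
  rw [h.norm_sq_eq hB, h.symmetry_of_mem_neg hx]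
  simp

theorem norm_sq_eq_add (x : V) :
    letI := h.normedAddCommGroup hB
    ‖x‖ ^ 2 = ‖h.posPart x‖ ^ 2 + ‖h.negPart x‖ ^ 2 := by
  rw [h.norm_sq_eq_of_mem_pos hB (h.posPart_mem x), h.norm_sq_eq_of_mem_neg hB (h.negPart_mem x),
    h.norm_sq_eq hB, h.apply_symmetry hB, Complex.sub_re]
  ring

theorem re_apply_eq (x : V) :
    letI := h.normedAddCommGroup hB
    (B x x).re = ‖h.posPart x‖ ^ 2 - ‖h.negPart x‖ ^ 2 := by
  rw [h.norm_sq_eq_of_mem_pos hB (h.posPart_mem x), h.norm_sq_eq_of_mem_neg hB (h.negPart_mem x),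
    h.apply_eq hB, Complex.add_re]
  ring

theorem norm_posPart_le (x : V) :
    letI := h.normedAddCommGroup hB
    ‖h.posPart x‖ ≤ ‖x‖ := by
  let := h.normedAddCommGroup hB
  refine le_of_sq_le_sq ?_ (norm_nonneg _)
  rw [h.norm_sq_eq_add hB x]
  linarith [sq_nonneg ‖h.negPart x‖]

theorem norm_negPart_le (x : V) :
    letI := h.normedAddCommGroup hB
    ‖h.negPart x‖ ≤ ‖x‖ := by
  let := h.normedAddCommGroup hB
  refine le_of_sq_le_sq ?_ (norm_nonneg _)
  rw [h.norm_sq_eq_add hB x]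
  linarith [sq_nonneg ‖h.posPart x‖]

theorem norm_symmetry (x : V) :
    letI := h.normedAddCommGroup hB
    ‖h.symmetry x‖ = ‖x‖ := by
  let := h.normedAddCommGroup hB
  refine (sq_eq_sq₀ (norm_nonneg _) (norm_nonneg _)).1 ?_
  rw [h.norm_sq_eq hB, h.norm_sq_eq hB, h.symmetry_apply_left hB, h.symmetry_symmetry]

theorem norm_apply_le (x y : V) :
    letI := h.normedAddCommGroup hB
    ‖B x y‖ ≤ ‖x‖ * ‖y‖ := by
  let := h.normedAddCommGroup hB
  let := h.innerProductSpace hB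
  have := norm_inner_le_norm (𝕜 := ℂ) (h.symmetry y) x
  rw [h.inner_eq hB, h.symmetry_symmetry, h.norm_symmetry hB] at this
  linarith

/-- Positive components converge by the completeness clause of the decomposition, negative ones by
finite dimension. -/
theorem completeSpace :
    letI := h.normedAddCommGroup hB
    CompleteSpace V := by
  let := h.normedAddCommGroup hB
  let := h.innerProductSpace hB
  refine Metric.complete_of_cauchySeq_tendsto fun u hu => ?_
  have hp : ∃ x, Tendsto (fun n => h.posPart (u n)) atTop (𝓝 x) := by
    obtain ⟨x, hx, hlim⟩ := h.complete (fun n => h.posPart (u n)) (fun n => h.posPart_mem _) (by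
      intro ε hε
      obtain ⟨N, hN⟩ := Metric.cauchySeq_iff.1 hu (Real.sqrt ε) (Real.sqrt_pos.2 hε)
      refine ⟨N, fun i hi j hj => ?_⟩
      have h1 := hN i hi j hj
      rw [dist_eq_norm] at h1
      rw [← map_sub, ← h.norm_sq_eq_of_mem_pos hB (h.posPart_mem _)]
      have h2 := (h.norm_posPart_le hB (u i - u j)).trans_lt h1
      exact (Real.lt_sqrt (norm_nonneg _)).1 h2)
    refine ⟨x, tendsto_iff_norm_sub_tendsto_zero.2 ?_⟩
    have h3 := hlim.sqrt
    rw [Real.sqrt_zero] at h3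
    refine h3.congr fun n => ?_
    rw [← h.norm_sq_eq_of_mem_pos hB (Vp.sub_mem (h.posPart_mem _) hx),
      Real.sqrt_sq (norm_nonneg _)]
  have hm : ∃ x, Tendsto (fun n => h.negPart (u n)) atTop (𝓝 x) := by
    have := h.finiteDimensional
    have : CompleteSpace Vm := FiniteDimensional.complete ℂ Vm
    have hc : CauchySeq (fun n => (⟨h.negPart (u n), h.negPart_mem _⟩ : Vm)) := by
      refine Metric.cauchySeq_iff.2 fun ε hε => ?_
      obtain ⟨N, hN⟩ := Metric.cauchySeq_iff.1 hu ε hε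
      refine ⟨N, fun i hi j hj => ?_⟩
      refine lt_of_le_of_lt ?_ (hN i hi j hj)
      rw [dist_eq_norm, dist_eq_norm]
      have := h.norm_negPart_le hB (u i - u j)
      rw [map_sub] at this
      exact this
    obtain ⟨x, hx⟩ := cauchySeq_tendsto_of_complete hc
    exact ⟨x, (continuous_subtype_val.tendsto x).comp hx⟩
  obtain ⟨x, hx⟩ := hp
  obtain ⟨y, hy⟩ := hm
  refine ⟨x + y, (hx.add hy).congr fun n => h.posPart_add_negPart _⟩

/-- Bounded functionals on a subspace are represented by the form. -/
theorem exists_representer (W : Submodule ℂ V) (φ : W →ₗ[ℂ] ℂ) {M : ℝ} (hM : 0 ≤ M)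
    (hφ : ∀ u : W, ‖φ u‖ ^ 2 ≤ M ^ 2 * (B u (h.symmetry u)).re) :
    ∃ y : V, (∀ u : W, B u y = φ u) ∧ (B y (h.symmetry y)).re ≤ M ^ 2 := by
  let := h.normedAddCommGroup hB
  let := h.innerProductSpace hB
  have := h.completeSpace hB
  have hb : ∀ u : W, ‖φ u‖ ≤ M * ‖u‖ := by
    intro u
    refine le_of_sq_le_sq ?_ (by positivity)
    rw [mul_pow, Submodule.coe_norm, h.norm_sq_eq hB]
    exact hφ u
  -- Hahn–Banach extends φ without increasing its norm; the fundamental symmetry, an isometry, turns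
  -- the Riesz vector of the inner product into a representer for the form.
  obtain ⟨g, hg, hgn⟩ := exists_extension_norm_eq W (φ.mkContinuous M hb)
  refine ⟨h.symmetry ((InnerProductSpace.toDual ℂ V).symm g), fun u => ?_, ?_⟩
  · rw [← h.inner_eq hB, InnerProductSpace.toDual_symm_apply, hg]
    rfl
  · rw [← h.norm_sq_eq hB, h.norm_symmetry hB, LinearIsometryEquiv.norm_map, hgn]
    have := φ.mkContinuous_norm_le hM hb
    gcongr

/-- If x is Hilbert-orthogonal to W, then its image under the symmetry is form-orthogonal to W,
hence zero. -/
theorem dense_of_total {W : Submodule ℂ V} (hW : ∀ y, (∀ u ∈ W, B u y = 0) → y = 0) :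
    letI := h.normedAddCommGroup hB
    Dense (W : Set V) := by
  let := h.normedAddCommGroup hB
  let := h.innerProductSpace hB
  have := h.completeSpace hB
  rw [Submodule.dense_iff_topologicalClosure_eq_top, Submodule.topologicalClosure_eq_top_iff,
    Submodule.eq_bot_iff]
  intro x hx
  have h0 : h.symmetry x = 0 := by
    refine hW _ fun u hu => ?_
    rw [← h.inner_eq hB]
    exact (Submodule.mem_orthogonal' W x).1 hx u hu
  rw [← h.symmetry_symmetry x, h0, map_zero]

end IsFundamentalDecomposition

/-! ### Moving the negative subspace into a dense subspace -/

namespace IsFundamentalDecomposition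

variable {V : Type*} [AddCommGroup V] [Module ℂ V] {B : SesqForm V} {Vp Vm : Submodule ℂ V}

/-- A dense subspace contains, for every fundamental decomposition, a small perturbation of the
negative subspace. -/
theorem exists_perturbation (h : IsFundamentalDecomposition B Vp Vm) (hB : IsHermitianForm B)
    {W : Submodule ℂ V} (hW : ∀ y, (∀ u ∈ W, B u y = 0) → y = 0) :
    letI := h.normedAddCommGroup hB
    ∃ N : Submodule ℂ V, N ≤ W ∧ FiniteDimensional ℂ N ∧
      Module.finrank ℂ N = Module.finrank ℂ Vm ∧
      ∀ y ∈ N, y ≠ 0 → 4 * ‖h.posPart y‖ ^ 2 < ‖h.negPart y‖ ^ 2 := by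
  let := h.normedAddCommGroup hB
  let := h.innerProductSpace hB
  have := h.finiteDimensional
  have hd : Dense (W : Set V) := h.dense_of_total hB hW
  let n := Module.finrank ℂ Vm
  let e := Module.finBasis ℂ Vm
  have hp : Continuous h.posPart :=
    (h.posPart.mkContinuous 1 fun x => by simpa using h.norm_posPart_le hB x).continuous
  have hm : Continuous h.negPart :=
    (h.negPart.mkContinuous 1 fun x => by simpa using h.norm_negPart_le hB x).continuous
  let Φ : (Fin n → V) → (Fin n → ℂ) → V := fun d c => ∑ i, c i • d i
  have hΦ : Continuous fun q : (Fin n → V) × (Fin n → ℂ) => Φ q.1 q.2 := by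
    simp only [Φ]
    fun_prop
  -- At the basis of `Vm` the positive parts vanish and the strict inequality holds. It is an open
  -- condition, and compactness of the coefficient sphere makes it uniform under small changes of
  -- the basis vectors.
  have hev : ∀ᶠ d in 𝓝 (fun i => (e i : V)), ∀ c ∈ Metric.sphere (0 : Fin n → ℂ) 1,
      4 * ‖h.posPart (Φ d c)‖ ^ 2 < ‖h.negPart (Φ d c)‖ ^ 2 := by
    refine (isCompact_sphere _ _).eventually_forall_of_forall_eventually fun c hc => ?_
    refine ContinuousAt.eventually_lt (f := fun q : (Fin n → V) × (Fin n → ℂ) =>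
      4 * ‖h.posPart (Φ q.1 q.2)‖ ^ 2) (g := fun q => ‖h.negPart (Φ q.1 q.2)‖ ^ 2) ?_ ?_ ?_
    · exact (continuous_const.mul ((hp.comp hΦ).norm.pow 2)).continuousAt
    · exact ((hm.comp hΦ).norm.pow 2).continuousAt
    · have hmem : Φ (fun i => (e i : V)) c ∈ Vm :=
        Submodule.sum_mem _ fun i _ => Vm.smul_mem _ (e i).2
      have hne : Φ (fun i => (e i : V)) c ≠ 0 := by
        intro h0
        have h1 : ∑ i, c i • e i = 0 := by
          apply Subtype.ext
          simpa [Φ] using h0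
        have h2 : c = 0 := funext (Fintype.linearIndependent_iff.1 e.linearIndependent c h1)
        rw [h2] at hc
        simp at hc
      simp only [h.posPart_of_mem_neg hmem, h.negPart_of_mem hmem]
      have := pow_pos (norm_pos_iff.2 hne) 2
      simpa using this
  have hdn : Dense (Set.univ.pi fun _ : Fin n => (W : Set V)) := dense_pi _ fun _ _ => hd
  obtain ⟨d, hd2, hd1⟩ := hdn.inter_nhds_nonempty hev
  have hneg : ∀ c : Fin n → ℂ, c ≠ 0 →
      4 * ‖h.posPart (Φ d c)‖ ^ 2 < ‖h.negPart (Φ d c)‖ ^ 2 := by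
    intro c hc
    have hc0 : (0 : ℝ) < ‖c‖ := norm_pos_iff.2 hc
    have h1 := hd1 (((‖c‖⁻¹ : ℝ) : ℂ) • c) (by
      rw [mem_sphere_zero_iff_norm, norm_smul, Complex.norm_real, norm_inv, norm_norm,
        inv_mul_cancel₀ hc0.ne'])
    have h2 : Φ d (((‖c‖⁻¹ : ℝ) : ℂ) • c) = ((‖c‖⁻¹ : ℝ) : ℂ) • Φ d c := by
      simp [Φ, Finset.smul_sum, mul_smul]
    rw [h2, map_smul, map_smul, norm_smul, norm_smul, mul_pow, mul_pow, Complex.norm_real,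
      norm_inv, norm_norm] at h1
    have h3 : (0 : ℝ) < ‖c‖⁻¹ ^ 2 := by positivity
    refine lt_of_mul_lt_mul_left ?_ h3.le
    linarith
  -- A nontrivial vanishing combination would turn the strict inequality into 0 < 0.
  have hli : LinearIndependent ℂ d := by
    refine Fintype.linearIndependent_iff.2 fun c hc => ?_
    by_contra hne
    have h1 := hneg c (fun h0 => hne fun i => by simp [h0])
    rw [show Φ d c = 0 from hc] at h1
    simp at h1
  refine ⟨Submodule.span ℂ (Set.range d), ?_, ?_, ?_, ?_⟩
  · rw [Submodule.span_le]
    rintro _ ⟨i, rfl⟩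
    exact hd2 i (Set.mem_univ _)
  · exact FiniteDimensional.span_of_finite ℂ (Set.finite_range d)
  · rw [finrank_span_eq_card hli, Fintype.card_fin]
  · intro y hy hy0
    obtain ⟨c, rfl⟩ := (Submodule.mem_span_range_iff_exists_fun ℂ).1 hy
    exact hneg c fun h0 => hy0 (by simp [h0])

/-- A nearly negative subspace of full dimension is the negative part of a fundamental
decomposition. -/
theorem of_perturbation (h : IsFundamentalDecomposition B Vp Vm) (hB : IsHermitianForm B)
    {N : Submodule ℂ V} [FiniteDimensional ℂ N]
    (hdim : Module.finrank ℂ N = Module.finrank ℂ Vm)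
    (hN : letI := h.normedAddCommGroup hB
      ∀ y ∈ N, y ≠ 0 → 4 * ‖h.posPart y‖ ^ 2 < ‖h.negPart y‖ ^ 2) :
    IsFundamentalDecomposition B (formOrthogonal B N) N := by
  let := h.normedAddCommGroup hB
  let := h.innerProductSpace hB
  have := h.completeSpace hB
  have := h.finiteDimensional
  have hneg : ∀ y ∈ N, y ≠ 0 → (B y y).re < 0 := by
    intro y hy hy0
    rw [h.re_apply_eq hB]
    nlinarith [hN y hy hy0, sq_nonneg ‖h.posPart y‖]
  have hdef : ∀ y ∈ N, B y y = 0 → y = 0 := by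
    intro y hy h0
    by_contra hne
    have := hneg y hy hne
    simp [h0] at this
  -- The inequality forces `negPart` to be injective on N; equal dimensions make it onto.
  have hsurj : ∀ m ∈ Vm, ∃ y ∈ N, h.negPart y = m := by
    let L : N →ₗ[ℂ] Vm := (h.negPart.comp N.subtype).codRestrict Vm fun y => h.negPart_mem _
    have hinj : Function.Injective L := by
      rw [injective_iff_map_eq_zero]
      intro y hy
      by_contra hne
      have h1 := hN y y.2 (fun h0 => hne (Subtype.ext h0))
      have h2 : h.negPart y = 0 := congrArg Subtype.val hy
      rw [h2] at h1
      simp only [norm_zero] at h1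
      nlinarith [sq_nonneg ‖h.posPart y‖]
    intro m hm
    obtain ⟨y, hy⟩ := (LinearMap.injective_iff_surjective_of_finrank_eq_finrank hdim).1 hinj ⟨m, hm⟩
    exact ⟨y, y.2, congrArg Subtype.val hy⟩
  -- Take y in N with the negative part of x. Orthogonality gives ‖x₋‖² = Re [x₊, y₊] ≤ ‖x₊‖ ‖x₋‖ /
  -- 2, the factor 4 supplying the half. So 2‖x₋‖ ≤ ‖x₊‖, and 2[x, x] - ‖x‖² = ‖x₊‖² - 3‖x₋‖² ≥ 0.
  -- Thus form-Cauchy sequences in the companion are norm-Cauchy.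
  have hpos : ∀ x ∈ formOrthogonal B N, ‖x‖ ^ 2 ≤ 2 * (B x x).re := by
    intro x hx
    obtain ⟨y, hy, hyx⟩ := hsurj _ (h.negPart_mem x)
    have h1 : ‖h.negPart x‖ ^ 2 = (B (h.posPart x) (h.posPart y)).re := by
      have h2 := congrArg Complex.re (hx y hy)
      rw [h.apply_eq hB, hyx, Complex.add_re, Complex.zero_re] at h2
      rw [h.norm_sq_eq_of_mem_neg hB (h.negPart_mem x)]
      linarith
    have h2 : (B (h.posPart x) (h.posPart y)).re ≤ ‖h.posPart x‖ * ‖h.posPart y‖ :=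
      (Complex.re_le_norm _).trans (h.norm_apply_le hB _ _)
    have h3 : 4 * ‖h.posPart y‖ ^ 2 ≤ ‖h.negPart x‖ ^ 2 := by
      rw [← hyx]
      rcases eq_or_ne y 0 with rfl | hy0
      · simp
      · exact (hN y hy hy0).le
    rw [h.norm_sq_eq_add hB, h.re_apply_eq hB]
    have h4 : 2 * ‖h.posPart y‖ ≤ ‖h.negPart x‖ :=
      le_of_sq_le_sq (by nlinarith) (norm_nonneg _)
    have h5 : ‖h.negPart x‖ ^ 2 * 2 ≤ ‖h.posPart x‖ * ‖h.negPart x‖ := by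
      nlinarith [norm_nonneg (h.posPart x)]
    have h6 : 2 * ‖h.negPart x‖ ≤ ‖h.posPart x‖ := by
      rcases (norm_nonneg (h.negPart x)).eq_or_lt with h0 | h0
      · rw [← h0]
        simp
      · nlinarith
    nlinarith [norm_nonneg (h.negPart x)]
  refine ⟨⟨?_, ?_⟩, fun p hp m hm => hp m hm, ?_, hneg, inferInstance, ?_⟩
  · rw [Submodule.disjoint_def]
    exact fun x hx hxN => hdef x hxN (hx x hxN)
  · rw [codisjoint_iff, eq_top_iff]
    intro x _
    obtain ⟨y, hy, hxy⟩ := exists_sub_mem_formOrthogonal (B := B) N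
      (fun y hy hz => hdef y hy (hz y hy)) x
    exact Submodule.mem_sup.2 ⟨x - y, hxy, y, hy, sub_add_cancel x y⟩
  · intro x hx hx0
    have := hpos x hx
    have := norm_pos_iff.2 hx0
    nlinarith
  · intro u hu hc
    have hcau : CauchySeq u := by
      refine Metric.cauchySeq_iff.2 fun ε hε => ?_
      obtain ⟨K, hK⟩ := hc (ε ^ 2 / 2) (by positivity)
      refine ⟨K, fun i hi j hj => ?_⟩
      rw [dist_eq_norm]
      have h1 := hpos _ (Submodule.sub_mem _ (hu i) (hu j))
      have h2 := hK i hi j hj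
      exact lt_of_pow_lt_pow_left₀ 2 hε.le (by linarith)
    obtain ⟨x, hx⟩ := cauchySeq_tendsto_of_complete hcau
    refine ⟨x, fun y hy => ?_, ?_⟩
    · have h1 : Tendsto (fun n => B (u n) y) atTop (𝓝 (B x y)) := by
        let F : V →L[ℂ] ℂ := (B.flip y).mkContinuous ‖y‖ fun v => by
          rw [mul_comm]
          exact h.norm_apply_le hB v y
        exact (F.continuous.tendsto x).comp hx
      refine tendsto_nhds_unique h1 ?_
      simp only [hu _ y hy]
      exact tendsto_const_nhds
    · have h1 := (tendsto_iff_norm_sub_tendsto_zero.1 hx).pow 2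
      rw [zero_pow two_ne_zero] at h1
      refine squeeze_zero_norm (fun n => ?_) h1
      refine (Complex.abs_re_le_norm _).trans ?_
      rw [sq]
      exact h.norm_apply_le hB _ _

theorem exists_neg_le (h : IsFundamentalDecomposition B Vp Vm) (hB : IsHermitianForm B)
    {W : Submodule ℂ V} (hW : ∀ y, (∀ u ∈ W, B u y = 0) → y = 0) :
    ∃ Vp' Vm' : Submodule ℂ V, IsFundamentalDecomposition B Vp' Vm' ∧ Vm' ≤ W ∧
      Module.finrank ℂ Vm' = Module.finrank ℂ Vm := by
  obtain ⟨N, hNW, hfin, hdim, hN⟩ := h.exists_perturbation hB hW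
  exact ⟨_, N, h.of_perturbation hB hdim hN, hNW, hdim⟩

/-- The orthogonal companion of a maximal negative subspace is positive definite. -/
theorem pos_of_mem_formOrthogonal (h : IsFundamentalDecomposition B Vp Vm)
    (hB : IsHermitianForm B) {N : Submodule ℂ V} [FiniteDimensional ℂ N]
    (hdim : Module.finrank ℂ Vm ≤ Module.finrank ℂ N)
    (hN : ∀ y ∈ N, y ≠ 0 → (B y y).re < 0) {x : V} (hx : x ∈ formOrthogonal B N)
    (hx0 : x ≠ 0) : 0 < (B x x).re := by
  by_contra! hle
  have := h.finiteDimensional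
  let L : N × ℂ →ₗ[ℂ] Vm :=
    (h.negPart.comp (N.subtype.coprod (LinearMap.toSpanSingleton ℂ V x))).codRestrict Vm
      fun y => h.negPart_mem _
  -- By dimension some nontrivial y + c x has no negative part, although its square [y, y] + |c|²
  -- [x, x] is nonpositive; so it must vanish.
  have hker : LinearMap.ker L ≠ ⊥ := LinearMap.ker_ne_bot_of_finrank_lt (by simp; omega)
  obtain ⟨⟨y, c⟩, hyc, hne⟩ := Submodule.exists_mem_ne_zero_of_ne_bot hker
  have h1 : h.negPart (y + c • x) = 0 := congrArg Subtype.val hyc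
  have h2 : (y : V) + c • x ∈ Vp := by
    rw [← h.posPart_add_negPart (y + c • x), h1, add_zero]
    exact h.posPart_mem _
  have h3 : (B (y + c • x) (y + c • x)).re = (B y y).re + ‖c‖ ^ 2 * (B x x).re := by
    rw [hB.re_add_self, re_smul_self]
    have : B y (c • x) = 0 := by
      rw [map_smulₛₗ, hB.eq_zero_symm (hx y y.2), smul_zero]
    simp [this]
  have hyle : (B y y).re ≤ 0 := by
    rcases eq_or_ne (y : V) 0 with h0 | h0
    · simp [h0]
    · exact (hN y y.2 h0).le
  have hcx : ‖c‖ ^ 2 * (B x x).re ≤ 0 := mul_nonpos_of_nonneg_of_nonpos (by positivity) hle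
  have h4 : (y : V) + c • x = 0 := by
    by_contra h0
    linarith [h.pos _ h2 h0]
  have hy0 : (y : V) = 0 := by
    by_contra h0
    rw [h4] at h3
    simp only [map_zero, Complex.zero_re] at h3
    linarith [hN y y.2 h0]
  rw [hy0, zero_add, smul_eq_zero] at h4
  exact hne (Prod.ext (Subtype.ext hy0) (h4.resolve_right hx0))

end IsFundamentalDecomposition

/-! ### Adjoints of isometric relations -/

/-- Adjoint of a densely defined isometric relation between Pontryagin spaces of the same index:
it is everywhere defined and contractive. -/
theorem exists_adjoint_of_isometric_relation
    {V W : Type*} [AddCommGroup V] [Module ℂ V] [AddCommGroup W] [Module ℂ W]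
    {BV : SesqForm V} {BW : SesqForm W} (hBV : IsHermitianForm BV) (hBW : IsHermitianForm BW)
    {Vp Vm : Submodule ℂ V} {Wp Wm : Submodule ℂ W}
    (hV : IsFundamentalDecomposition BV Vp Vm) (hW : IsFundamentalDecomposition BW Wp Wm)
    (hdim : Module.finrank ℂ Vm = Module.finrank ℂ Wm)
    (R : Submodule ℂ (V × W)) (hR : ∀ r ∈ R, ∀ s ∈ R, BV r.1 s.1 = BW r.2 s.2)
    (htot : ∀ y, (∀ r ∈ R, BV r.1 y = 0) → y = 0) (x : W) :
    ∃ y : V, (∀ r ∈ R, BV r.1 y = BW r.2 x) ∧ (BV y y).re ≤ (BW x x).re := by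
  let D := R.map (LinearMap.fst ℂ V W)
  obtain ⟨Np, N, hN, hND, hNdim⟩ := hV.exists_neg_le hBV (W := D) (by
    intro y hy
    exact htot y fun r hr => hy r.1 ⟨r, hr, rfl⟩)
  have := hN.finiteDimensional
  -- A linear selection of the relation; that it is the only one is proved later.
  obtain ⟨L, hL⟩ : ∃ L : D →ₗ[ℂ] W, ∀ u : D, ((u : V), L u) ∈ R := by
    let p : R →ₗ[ℂ] D := ((LinearMap.fst ℂ V W).comp R.subtype).codRestrict D
      fun r => ⟨r, r.2, rfl⟩
    have hp : LinearMap.range p = ⊤ := by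
      rw [LinearMap.range_eq_top]
      rintro ⟨_, r, hr, rfl⟩
      exact ⟨⟨r, hr⟩, rfl⟩
    obtain ⟨g, hg⟩ := p.exists_rightInverse_of_surjective hp
    refine ⟨(LinearMap.snd ℂ V W).comp (R.subtype.comp g), fun u => ?_⟩
    have h1 : ((g u : R) : V × W).1 = u := congrArg Subtype.val (LinearMap.congr_fun hg u)
    have h2 := (g u).2
    rw [show ((u : V), ((LinearMap.snd ℂ V W).comp (R.subtype.comp g)) u) = ((g u : R) : V × W)
      from Prod.ext h1.symm rfl]
    exact h2
  have hiso : ∀ u v : D, BW (L u) (L v) = BV u v := fun u v => (hR _ (hL u) _ (hL v)).symm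
  let T : N →ₗ[ℂ] W := L.comp (Submodule.inclusion hND)
  have hT : ∀ u v : N, BW (T u) (T v) = BV u v := fun u v => hiso _ _
  have hTR : ∀ u : N, ((u : V), T u) ∈ R := fun u => hL (Submodule.inclusion hND u)
  let N' := LinearMap.range T
  have hneg : ∀ y ∈ N', y ≠ 0 → (BW y y).re < 0 := by
    rintro _ ⟨u, rfl⟩ hu
    rw [hT]
    refine hN.neg u u.2 fun h0 => hu ?_
    rw [show u = 0 from Subtype.ext h0, map_zero]
  have hinj : Function.Injective T := by
    rw [injective_iff_map_eq_zero]
    intro u hu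
    by_contra hne
    have h1 := hN.neg u u.2 fun h0 => hne (Subtype.ext h0)
    rw [← hT, hu] at h1
    simp at h1
  -- Equality of the indices makes the isometric image N' maximal negative, so its companion is
  -- positive definite.
  have hdim' : Module.finrank ℂ Wm ≤ Module.finrank ℂ N' := by
    rw [LinearMap.finrank_range_of_inj hinj, hNdim, hdim]
  have hpos : ∀ y ∈ formOrthogonal BW N', y ≠ 0 → 0 < (BW y y).re := fun y hy hy0 =>
    hW.pos_of_mem_formOrthogonal hBW hdim' hneg hy hy0
  have hnn : ∀ y ∈ formOrthogonal BW N', 0 ≤ (BW y y).re := by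
    intro y hy
    rcases eq_or_ne y 0 with rfl | h0
    · simp
    · exact (hpos y hy h0).le
  -- the relation is single valued
  have hsv : ∀ r ∈ R, ∀ u : D, r.1 = u → r.2 = L u := by
    intro r hr u hu
    by_contra hne
    have hmem : r - ((u : V), L u) ∈ R := R.sub_mem hr (hL u)
    have h1 : r.2 - L u ∈ formOrthogonal BW N' := by
      rintro _ ⟨v, rfl⟩
      have := hR _ hmem _ (hTR v)
      simp only [Prod.fst_sub, Prod.snd_sub, hu, sub_self, map_zero, LinearMap.zero_apply] at this
      exact this.symm
    have h2 := hpos _ h1 (sub_ne_zero.2 hne)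
    have h3 := hR _ hmem _ hmem
    simp only [Prod.fst_sub, Prod.snd_sub, hu, sub_self, map_zero] at h3
    rw [← h3] at h2
    simp at h2
  obtain ⟨_, ⟨m, rfl⟩, hx'⟩ := exists_sub_mem_formOrthogonal (B := BW) N' (fun y hy hz => by
    by_contra h0
    have := hneg y hy h0
    rw [hz y hy] at this
    simp at this) x
  let φ : D →ₗ[ℂ] ℂ := (BW.flip (x - T m)).comp L
  have hφ : ∀ u : D, φ u = BW (L u) (x - T m) := fun _ => rfl
  obtain ⟨y, hy, hyn⟩ := hN.exists_representer hBV D φ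
    (M := Real.sqrt (BW (x - T m) (x - T m)).re) (Real.sqrt_nonneg _) (by
      intro u
      rw [Real.sq_sqrt (hnn _ hx')]
      -- Subtracting the negative component moves L u into the positive companion of N', where its
      -- square is [u₊, u₊]. Cauchy–Schwarz there bounds φ with exactly the constant needed for
      -- contractivity.
      let um : N := ⟨hN.negPart u, hN.negPart_mem _⟩
      have horth : L u - T um ∈ formOrthogonal BW N' := by
        rintro _ ⟨v, rfl⟩
        have h1 : BW (L u) (T v) = BV u v := hiso _ _
        rw [map_sub, LinearMap.sub_apply, h1, hT, ← LinearMap.sub_apply, ← map_sub]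
        have h2 : (u : V) - um = hN.posPart u := by
          rw [sub_eq_iff_eq_add]
          exact (hN.posPart_add_negPart u).symm
        rw [h2]
        exact hN.orthogonal _ (hN.posPart_mem _) _ v.2
      have h1 : φ u = BW (L u - T um) (x - T m) := by
        rw [hφ, map_sub BW (L u), LinearMap.sub_apply, hBW.eq_zero_symm (hx' (T um) ⟨um, rfl⟩), sub_zero]
      have h2 : (BW (L u - T um) (L u - T um)).re ≤ (BV u (hN.symmetry u)).re := by
        have h3 : L u - T um = L (u - Submodule.inclusion hND um) := by
          rw [map_sub]; rfl
        rw [h3, hiso]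
        have h4 : ((u - Submodule.inclusion hND um : D) : V) = hN.posPart u := by
          change (u : V) - hN.negPart u = hN.posPart u
          rw [sub_eq_iff_eq_add]
          exact (hN.posPart_add_negPart u).symm
        rw [h4, hN.apply_symmetry hBV, Complex.sub_re]
        linarith [hN.re_negPart_nonpos u]
      rw [h1, mul_comm]
      exact (hBW.norm_sq_le_of_nonneg _ hnn horth hx').trans
        (mul_le_mul_of_nonneg_right h2 (hnn _ hx')))
  rw [Real.sq_sqrt (hnn _ hx')] at hyn
  have hyN : ∀ v : N, BV v y = 0 := by
    intro v
    have h1 := hy (Submodule.inclusion hND v)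
    rw [hφ] at h1
    exact h1.trans (hBW.eq_zero_symm (hx' (T v) ⟨v, rfl⟩))
  -- The summand m accounts for T m and y for x - T m; since y is orthogonal to N, the squares add.
  refine ⟨m + y, fun r hr => ?_, ?_⟩
  · let u : D := ⟨r.1, r, hr, rfl⟩
    have h1 := hy u
    have h2 : BV r.1 m = BW r.2 (T m) := hR _ hr _ (hTR m)
    rw [hφ, ← hsv r hr u rfl] at h1
    rw [map_add, h2, show BV r.1 y = _ from h1, ← map_add]
    simp
  · have h1 : (BW x x).re = (BV m m).re + (BW (x - T m) (x - T m)).re := by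
      conv_lhs => rw [← add_sub_cancel (T m) x]
      rw [hBW.re_add_self, hT, hBW.eq_zero_symm (hx' (T m) ⟨m, rfl⟩)]
      simp
    rw [hBV.re_add_self, hyN, h1]
    have := hN.re_apply_le hBV y
    simp only [Complex.zero_re]
    linarith

/-! ### Orthogonal sums -/

section Product

variable {V W : Type*} [AddCommGroup V] [Module ℂ V] [AddCommGroup W] [Module ℂ W]

/-- A product of subspaces as a subspace of the product. -/
def submoduleProdEquiv (p : Submodule ℂ V) (q : Submodule ℂ W) : (p × q) ≃ₗ[ℂ] p.prod q where
  toFun x := ⟨(x.1, x.2), x.1.2, x.2.2⟩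
  invFun x := (⟨x.1.1, x.2.1⟩, ⟨x.1.2, x.2.2⟩)
  map_add' _ _ := rfl
  map_smul' _ _ := rfl

/-- The orthogonal sum of two forms. -/
def prodForm (BV : SesqForm V) (BW : SesqForm W) : SesqForm (V × W) :=
  LinearMap.mk₂'ₛₗ (RingHom.id ℂ) (starRingEnd ℂ) (fun x y => BV x.1 y.1 + BW x.2 y.2)
    (fun x y z => by simp; ring) (fun c x y => by simp; ring)
    (fun x y z => by simp; ring) (fun c x y => by simp; ring)

@[simp] theorem prodForm_apply (BV : SesqForm V) (BW : SesqForm W) (x y : V × W) :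
    prodForm BV BW x y = BV x.1 y.1 + BW x.2 y.2 := rfl

theorem IsHermitianForm.prod {BV : SesqForm V} {BW : SesqForm W} (hV : IsHermitianForm BV)
    (hW : IsHermitianForm BW) : IsHermitianForm (prodForm BV BW) := fun x y => by
  rw [prodForm_apply, prodForm_apply, map_add, ← hV, ← hW]

theorem IsFundamentalDecomposition.prod {BV : SesqForm V} {BW : SesqForm W}
    {Vp Vm : Submodule ℂ V} {Wp Wm : Submodule ℂ W}
    (hV : IsFundamentalDecomposition BV Vp Vm) (hW : IsFundamentalDecomposition BW Wp Wm) :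
    IsFundamentalDecomposition (prodForm BV BW) (Vp.prod Wp) (Vm.prod Wm) where
  isCompl := by
    refine ⟨?_, ?_⟩
    · rw [Submodule.disjoint_def]
      rintro ⟨x, y⟩ ⟨h1, h2⟩ ⟨h3, h4⟩
      exact Prod.ext (Submodule.disjoint_def.1 hV.isCompl.disjoint x h1 h3)
        (Submodule.disjoint_def.1 hW.isCompl.disjoint y h2 h4)
    · rw [codisjoint_iff, eq_top_iff]
      rintro ⟨x, y⟩ -
      exact Submodule.mem_sup.2 ⟨(hV.posPart x, hW.posPart y),
        ⟨hV.posPart_mem x, hW.posPart_mem y⟩, (hV.negPart x, hW.negPart y),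
        ⟨hV.negPart_mem x, hW.negPart_mem y⟩,
        Prod.ext (hV.posPart_add_negPart x) (hW.posPart_add_negPart y)⟩
  orthogonal := by
    rintro p ⟨h1, h2⟩ m ⟨h3, h4⟩
    rw [prodForm_apply, hV.orthogonal _ h1 _ h3, hW.orthogonal _ h2 _ h4, add_zero]
  pos := by
    rintro ⟨x, y⟩ ⟨h1, h2⟩ hne
    change x ∈ Vp at h1
    change y ∈ Wp at h2
    change 0 < (BV x x + BW y y).re
    rw [Complex.add_re]
    by_cases hx : x = 0
    · have hy : y ≠ 0 := fun hy => hne (by rw [hx, hy]; rfl)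
      simpa [hx] using hW.pos y h2 hy
    · by_cases hy : y = 0
      · simpa [hy] using hV.pos x h1 hx
      · linarith [hV.pos x h1 hx, hW.pos y h2 hy]
  neg := by
    rintro ⟨x, y⟩ ⟨h1, h2⟩ hne
    change x ∈ Vm at h1
    change y ∈ Wm at h2
    change (BV x x + BW y y).re < 0
    rw [Complex.add_re]
    by_cases hx : x = 0
    · have hy : y ≠ 0 := fun hy => hne (by rw [hx, hy]; rfl)
      simpa [hx] using hW.neg y h2 hy
    · by_cases hy : y = 0
      · simpa [hy] using hV.neg x h1 hx
      · linarith [hV.neg x h1 hx, hW.neg y h2 hy]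
  finiteDimensional := by
    have := hV.finiteDimensional
    have := hW.finiteDimensional
    exact Module.Finite.equiv (submoduleProdEquiv Vm Wm)
  complete := by
    intro u hu hc
    have hnV : ∀ x ∈ Vp, 0 ≤ (BV x x).re := fun x hx => by
      simpa [hV.posPart_of_mem hx] using hV.re_posPart_nonneg x
    have hnW : ∀ x ∈ Wp, 0 ≤ (BW x x).re := fun x hx => by
      simpa [hW.posPart_of_mem hx] using hW.re_posPart_nonneg x
    obtain ⟨x, hx, hxl⟩ := hV.complete (fun n => (u n).1) (fun n => (hu n).1) (by
      intro ε hε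
      obtain ⟨K, hK⟩ := hc ε hε
      refine ⟨K, fun i hi j hj => ?_⟩
      have h1 := hK i hi j hj
      rw [prodForm_apply, Complex.add_re] at h1
      have := hnW _ (Wp.sub_mem (hu i).2 (hu j).2)
      simp only [Prod.fst_sub, Prod.snd_sub] at h1
      linarith)
    obtain ⟨y, hy, hyl⟩ := hW.complete (fun n => (u n).2) (fun n => (hu n).2) (by
      intro ε hε
      obtain ⟨K, hK⟩ := hc ε hε
      refine ⟨K, fun i hi j hj => ?_⟩
      have h1 := hK i hi j hj
      rw [prodForm_apply, Complex.add_re] at h1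
      have := hnV _ (Vp.sub_mem (hu i).1 (hu j).1)
      simp only [Prod.fst_sub, Prod.snd_sub] at h1
      linarith)
    refine ⟨(x, y), ⟨hx, hy⟩, ?_⟩
    have := hxl.add hyl
    rw [add_zero] at this
    exact this

theorem finrank_submodule_prod (p : Submodule ℂ V) (q : Submodule ℂ W)
    [FiniteDimensional ℂ p] [FiniteDimensional ℂ q] :
    Module.finrank ℂ (p.prod q) = Module.finrank ℂ p + Module.finrank ℂ q := by
  rw [← Module.finrank_prod, (submoduleProdEquiv p q).finrank_eq]

end Product

/-! ### Riesz representation and adjoints in the given norm -/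

theorem IsFundamentalDecomposition.norm_sq_apply_le {V : Type*} [AddCommGroup V] [Module ℂ V]
    {B : SesqForm V} {Vp Vm : Submodule ℂ V} (h : IsFundamentalDecomposition B Vp Vm)
    (hB : IsHermitianForm B) (x y : V) :
    ‖B x y‖ ^ 2 ≤ (B x (h.symmetry x)).re * (B y (h.symmetry y)).re := by
  let := h.normedAddCommGroup hB
  rw [← h.norm_sq_eq hB, ← h.norm_sq_eq hB, ← mul_pow]
  exact pow_le_pow_left₀ (norm_nonneg _) (h.norm_apply_le hB x y) 2

namespace IsTopPontryagin

variable {V : Type*} [NormedAddCommGroup V] [NormedSpace ℂ V] {B : SesqForm V} {k : ℕ}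

theorem exists_equivalent (hV : IsTopPontryagin B k) :
    ∃ (Vp Vm : Submodule ℂ V) (h : IsFundamentalDecomposition B Vp Vm),
      Module.finrank ℂ Vm = k ∧ ∃ c₁ > (0 : ℝ), ∃ c₂ > (0 : ℝ), ∀ x,
        c₁ * ‖x‖ ^ 2 ≤ (B x (h.symmetry x)).re ∧ (B x (h.symmetry x)).re ≤ c₂ * ‖x‖ ^ 2 := by
  obtain ⟨hB, Vp, Vm, h, hk, c₁, h₁, c₂, h₂, hc⟩ := hV
  refine ⟨Vp, Vm, h, hk, c₁, h₁, c₂, h₂, fun x => ?_⟩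
  have := hc _ (h.posPart_mem x) _ (h.negPart_mem x)
  rwa [h.posPart_add_negPart, ← Complex.sub_re, ← h.apply_symmetry hB] at this

/-- The form is continuous. -/
theorem exists_norm_apply_le (hV : IsTopPontryagin B k) :
    ∃ M > (0 : ℝ), ∀ x y, ‖B x y‖ ≤ M * ‖x‖ * ‖y‖ := by
  obtain ⟨Vp, Vm, h, -, c₁, h₁, c₂, h₂, hc⟩ := hV.exists_equivalent
  refine ⟨c₂, h₂, fun x y => le_of_sq_le_sq ?_ (by positivity)⟩
  calc ‖B x y‖ ^ 2 ≤ _ := h.norm_sq_apply_le hV.1 x y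
    _ ≤ (c₂ * ‖x‖ ^ 2) * (c₂ * ‖y‖ ^ 2) :=
        mul_le_mul (hc x).2 (hc y).2 (h.re_symmetry_nonneg hV.1 y) (by positivity)
    _ = _ := by ring

/-- The norm of a vector is controlled by that of the functional it represents. -/
theorem exists_norm_le (hV : IsTopPontryagin B k) :
    ∃ M > (0 : ℝ), ∀ (x : V) (K : ℝ), 0 ≤ K → (∀ y, ‖B x y‖ ≤ K * ‖y‖) → ‖x‖ ≤ M * K := by
  obtain ⟨Vp, Vm, h, -, c₁, h₁, c₂, h₂, hc⟩ := hV.exists_equivalent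
  refine ⟨Real.sqrt (c₂ / c₁) / c₁, by positivity, fun x K hK hx => ?_⟩
  -- The symmetry is isometric only for the Hilbert norm; passing to the given norm costs √(c₂/c₁).
  -- The functional is then tested on the symmetric image of x.
  have h3 : ‖h.symmetry x‖ ≤ Real.sqrt (c₂ / c₁) * ‖x‖ := by
    refine le_of_sq_le_sq ?_ (by positivity)
    rw [mul_pow, Real.sq_sqrt (by positivity), div_mul_eq_mul_div, le_div_iff₀ h₁, mul_comm]
    have h4 := (hc (h.symmetry x)).1
    rw [h.symmetry_apply_left hV.1, h.symmetry_symmetry] at h4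
    exact h4.trans (hc x).2
  have h5 : c₁ * ‖x‖ ^ 2 ≤ K * (Real.sqrt (c₂ / c₁) * ‖x‖) :=
    (hc x).1.trans <| (Complex.re_le_norm _).trans <| (hx _).trans <|
      mul_le_mul_of_nonneg_left h3 hK
  rcases (norm_nonneg x).eq_or_lt with h0 | h0
  · rw [← h0]
    positivity
  · rw [div_mul_eq_mul_div, le_div_iff₀ h₁]
    refine le_of_mul_le_mul_right ?_ h0
    linarith

theorem eq_zero (hV : IsTopPontryagin B k) {x : V} (hx : ∀ y, B x y = 0) : x = 0 := by
  obtain ⟨M, -, hM⟩ := hV.exists_norm_le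
  have := hM x 0 le_rfl fun y => by simp [hx]
  rw [mul_zero] at this
  exact norm_le_zero_iff.1 this

theorem ext (hV : IsTopPontryagin B k) {x y : V} (h : ∀ z, B x z = B y z) : x = y :=
  sub_eq_zero.1 (hV.eq_zero fun z => by rw [map_sub, LinearMap.sub_apply, h, sub_self])

theorem ext_right (hV : IsTopPontryagin B k) {x y : V} (h : ∀ z, B z x = B z y) : x = y :=
  hV.ext fun z => by rw [hV.1 z, h, ← hV.1]

/-- The Riesz representation theorem. -/
theorem exists_apply_eq (hV : IsTopPontryagin B k) (φ : V →L[ℂ] ℂ) : ∃ y, ∀ x, B x y = φ x := by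
  obtain ⟨Vp, Vm, h, -, c₁, h₁, c₂, h₂, hc⟩ := hV.exists_equivalent
  obtain ⟨y, hy, -⟩ := h.exists_representer hV.1 ⊤ ((φ : V →ₗ[ℂ] ℂ).comp (Submodule.subtype ⊤))
    (M := ‖φ‖ / Real.sqrt c₁) (by positivity) (fun u => by
      rw [div_pow, Real.sq_sqrt h₁.le, div_mul_eq_mul_div, le_div_iff₀ h₁]
      calc ‖φ u‖ ^ 2 * c₁ ≤ (‖φ‖ * ‖(u : V)‖) ^ 2 * c₁ := by
            gcongr
            exact φ.le_opNorm _
        _ = ‖φ‖ ^ 2 * (c₁ * ‖(u : V)‖ ^ 2) := by ring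
        _ ≤ _ := by
            gcongr
            exact (hc u).1)
  exact ⟨y, fun x => hy ⟨x, Submodule.mem_top⟩⟩

variable {W : Type*} [NormedAddCommGroup W] [NormedSpace ℂ W] {BW : SesqForm W} {l : ℕ}

/-- The constant does not depend on T, so local boundedness of S(z) passes to S(z)*. -/
theorem exists_norm_adjoint_le (hV : IsTopPontryagin B k) (hW : IsTopPontryagin BW l) :
    ∃ M > (0 : ℝ), ∀ (T : W →L[ℂ] V) (c : V) (t : W), (∀ d, B (T d) c = BW d t) →
      ‖t‖ ≤ M * ‖T‖ * ‖c‖ := by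
  obtain ⟨M₁, h₁, hM₁⟩ := hV.exists_norm_apply_le
  obtain ⟨M₂, h₂, hM₂⟩ := hW.exists_norm_le
  refine ⟨M₂ * M₁, by positivity, fun T c t ht => ?_⟩
  refine (hM₂ t (M₁ * ‖T‖ * ‖c‖) (by positivity) fun d => ?_).trans_eq (by ring)
  rw [hW.1 d t, RCLike.norm_conj, ← ht]
  calc ‖B (T d) c‖ ≤ M₁ * ‖T d‖ * ‖c‖ := hM₁ _ _
    _ ≤ M₁ * (‖T‖ * ‖d‖) * ‖c‖ := by
        gcongr
        exact T.le_opNorm d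
    _ = _ := by ring

theorem exists_adjoint (hV : IsTopPontryagin B k) (hW : IsTopPontryagin BW l) (T : W →L[ℂ] V) :
    ∃ T' : V →L[ℂ] W, ∀ d c, B (T d) c = BW d (T' c) := by
  obtain ⟨M, -, hM⟩ := hV.exists_norm_apply_le
  have hex : ∀ c, ∃ t, ∀ d, B (T d) c = BW d t := by
    intro c
    obtain ⟨t, ht⟩ := hW.exists_apply_eq
      (((B.flip c).mkContinuous (M * ‖c‖) fun v => by
        have := hM v c
        rw [LinearMap.flip_apply]
        linarith).comp T)
    exact ⟨t, fun d => (ht d).symm⟩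
  choose t ht using hex
  obtain ⟨M', -, hM'⟩ := hV.exists_norm_adjoint_le hW
  exact ⟨LinearMap.mkContinuous
    { toFun := t
      map_add' := fun c c' => hW.ext_right fun d => by
        rw [← ht, map_add, map_add, ht, ht]
      map_smul' := fun a c => hW.ext_right fun d => by
        rw [← ht, map_smulₛₗ, RingHom.id_apply, map_smulₛₗ, ht] } (M' * ‖T‖)
    fun c => hM' T c (t c) (ht c), fun d c => ht c d⟩

/-- Existence of the adjoint excludes the placeholder branch of the definition. -/
theorem apply_adjoint (hV : IsTopPontryagin B k) (hW : IsTopPontryagin BW l) (T : W →L[ℂ] V)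
    (d : W) (c : V) : B (T d) c = BW d (pontryaginAdjoint B BW T c) := by
  have h := hV.exists_adjoint hW T
  rw [pontryaginAdjoint, dif_pos h]
  exact h.choose_spec d c

end IsTopPontryagin

/-! ### Continuity of elements of a reproducing kernel Pontryagin space -/

/-- Functions in a reproducing kernel Pontryagin space are continuous when the kernel is
continuous in its first variable and locally bounded on the diagonal. -/
theorem IsFundamentalDecomposition.continuous_of_reproducing
    {V : Type*} [AddCommGroup V] [Module ℂ V] {B : SesqForm V} {Vp Vm : Submodule ℂ V}
    (h₀ : IsFundamentalDecomposition B Vp Vm) (hB : IsHermitianForm B)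
    {C : Type*} [NormedAddCommGroup C] [NormedSpace ℂ C] {BC : SesqForm C} {k : ℕ}
    (hC : IsTopPontryagin BC k) {X : Type*} [TopologicalSpace X]
    (ev : X → V →ₗ[ℂ] C) (K : X → C → V)
    (hrep : ∀ f x c, B f (K x c) = BC (ev x f) c)
    (hsep : ∀ f, (∀ x, ev x f = 0) → f = 0)
    (hcont : ∀ w c, Continuous fun x => ev x (K w c))
    (hloc : ∀ x₀, ∃ M : ℝ, ∀ᶠ x in 𝓝 x₀, ∀ c, (BC (ev x (K x c)) c).re ≤ M * ‖c‖ ^ 2) (f : V) :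
    Continuous fun x => ev x f := by
  let W : Submodule ℂ V := Submodule.span ℂ (Set.range fun q : X × C => K q.1 q.2)
  have hW : ∀ y, (∀ u ∈ W, B u y = 0) → y = 0 := fun y hy => hsep y fun x =>
    hC.eq_zero fun c => by
      rw [← hrep]
      exact hB.eq_zero_symm (hy _ (Submodule.subset_span ⟨(x, c), rfl⟩))
  have hWc : ∀ u ∈ W, Continuous fun x => ev x u := by
    intro u hu
    induction hu using Submodule.span_induction with
    | mem u hu =>
      obtain ⟨⟨w, c⟩, rfl⟩ := hu
      exact hcont w c
    | zero => simpa using continuous_const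
    | add u v _ _ hu hv =>
      simp only [map_add]
      exact hu.add hv
    | smul a u _ hu =>
      simp only [map_smul]
      exact hu.const_smul a
  -- With N inside the span of the kernels, its elements are already known to be continuous, so
  -- evaluation on N is locally bounded.
  obtain ⟨Np, N, h, hNW, -⟩ := h₀.exists_neg_le hB hW
  let := h.normedAddCommGroup hB
  let := h.innerProductSpace hB
  have := h.finiteDimensional
  have hd : Dense (W : Set V) := h.dense_of_total hB hW
  obtain ⟨M₁, hM₁, hbound⟩ := hC.exists_norm_apply_le
  obtain ⟨M₂, hM₂, hnorm⟩ := hC.exists_norm_le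
  let e := stdOrthonormalBasis ℂ N
  let L : X → ℝ := fun x => ∑ i, ‖ev x (e i)‖
  have hL : Continuous L := continuous_finsetSum _ fun i _ => (hWc _ (hNW (e i).2)).norm
  have hL0 : ∀ x, 0 ≤ L x := fun x => Finset.sum_nonneg fun i _ => norm_nonneg _
  have hevN : ∀ x, ∀ m ∈ N, ‖ev x m‖ ≤ L x * ‖m‖ := by
    intro x m hm
    have h1 : m = ∑ i, inner ℂ (e i) (⟨m, hm⟩ : N) • (e i : V) := by
      have := congrArg N.subtype (e.sum_repr' ⟨m, hm⟩)
      rw [map_sum] at this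
      exact this.symm
    have h2 : ev x m = ∑ i, inner ℂ (e i) (⟨m, hm⟩ : N) • ev x (e i) := by
      conv_lhs => rw [h1]
      simp only [map_sum, map_smul]
    rw [h2, Finset.sum_mul]
    refine (norm_sum_le _ _).trans (Finset.sum_le_sum fun i _ => ?_)
    rw [norm_smul, mul_comm]
    refine mul_le_mul_of_nonneg_left ?_ (norm_nonneg _)
    have h3 := norm_inner_le_norm (𝕜 := ℂ) (e i) (⟨m, hm⟩ : N)
    rwa [e.norm_eq_one, one_mul] at h3
  -- For m = (K_x c)₋ one has ‖m‖² = -[m, K_x c] = -[m(x), c], which involves only evaluation on N.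
  have hneg : ∀ x c, ‖h.negPart (K x c)‖ ≤ M₁ * L x * ‖c‖ := by
    intro x c
    set m := h.negPart (K x c) with hm
    have hmN : m ∈ N := h.negPart_mem _
    have h1 : ‖m‖ ^ 2 ≤ M₁ * (L x * ‖m‖) * ‖c‖ := by
      rw [h.norm_sq_eq_of_mem_neg hB hmN]
      have h2 : B m m = BC (ev x m) c := by
        rw [← hrep, h.apply_eq hB m (K x c), h.posPart_of_mem_neg hmN, h.negPart_of_mem hmN]
        simp [hm]
      rw [h2, ← Complex.neg_re]
      refine (Complex.re_le_norm _).trans ?_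
      rw [norm_neg]
      refine (hbound _ _).trans ?_
      gcongr
      exact hevN x m hmN
    rcases (norm_nonneg m).eq_or_lt with h0 | h0
    · rw [← h0]
      have := hL0 x
      positivity
    · refine le_of_mul_le_mul_right ?_ h0
      linarith
  -- the point evaluations are locally uniformly bounded
  have hev : ∀ x₀, ∃ Q : ℝ, ∀ᶠ x in 𝓝 x₀, ∀ g, ‖ev x g‖ ≤ Q * ‖g‖ := by
    intro x₀
    obtain ⟨M, hM⟩ := hloc x₀
    let Λ := L x₀ + 1
    have hΛ : 0 ≤ Λ := by have := hL0 x₀; positivity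
    -- From ‖K_x c‖² = [K_x c, K_x c] + 2‖(K_x c)₋‖²; the added 1 gives Q ≤ Q².
    let Q := 1 + |M| + 2 * (M₁ * Λ) ^ 2
    have hQ : 1 ≤ Q := by
      have : 0 ≤ |M| + 2 * (M₁ * Λ) ^ 2 := by positivity
      linarith
    refine ⟨M₂ * Q, ?_⟩
    filter_upwards [hM, hL.continuousAt.eventually_lt continuousAt_const (lt_add_one (L x₀))]
      with x hx hxL g
    have hk : ∀ c, ‖K x c‖ ≤ Q * ‖c‖ := by
      intro c
      refine le_of_sq_le_sq ?_ (by positivity)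
      have h1 : ‖K x c‖ ^ 2 = (B (K x c) (K x c)).re + 2 * ‖h.negPart (K x c)‖ ^ 2 := by
        rw [h.re_apply_eq hB, h.norm_sq_eq_add hB]
        ring
      have h2 : ‖h.negPart (K x c)‖ ≤ M₁ * Λ * ‖c‖ := by
        refine (hneg x c).trans ?_
        gcongr
      have h3 := hx c
      rw [← hrep] at h3
      calc ‖K x c‖ ^ 2 ≤ |M| * ‖c‖ ^ 2 + 2 * (M₁ * Λ * ‖c‖) ^ 2 := by
            rw [h1]
            refine add_le_add (h3.trans ?_) (by gcongr)
            gcongr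
            exact le_abs_self M
        _ ≤ Q * ‖c‖ ^ 2 := by
            simp only [Q]
            nlinarith [sq_nonneg ‖c‖]
        _ ≤ Q ^ 2 * ‖c‖ ^ 2 := by
            gcongr
            nlinarith
        _ = _ := by ring
    refine (hnorm _ (Q * ‖g‖) (by positivity) fun c => ?_).trans_eq (by ring)
    rw [← hrep]
    refine (h.norm_apply_le hB _ _).trans ?_
    calc ‖g‖ * ‖K x c‖ ≤ ‖g‖ * (Q * ‖c‖) := by
          gcongr
          exact hk c
      _ = _ := by ring
  refine continuous_iff_continuousAt.2 fun x₀ => ?_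
  obtain ⟨Q, hQ⟩ := hev x₀
  -- Locally bounded evaluations turn norm approximation by the span of kernels into locally uniform
  -- approximation by continuous functions.
  refine continuousAt_of_locally_uniform_approx_of_continuousAt fun s hs => ?_
  obtain ⟨ε, hε, hεs⟩ := Metric.mem_uniformity_dist.1 hs
  obtain ⟨u, huW, hu⟩ := Metric.dense_iff.1 hd f (ε / (|Q| + 1)) (by positivity)
  refine ⟨_, hQ, fun x => ev x u, (hWc u hu).continuousAt, fun x hx => hεs ?_⟩
  rw [dist_eq_norm, ← map_sub]
  rw [Metric.mem_ball, dist_comm, dist_eq_norm, lt_div_iff₀ (by positivity)] at huW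
  refine (hx _).trans_lt (lt_of_le_of_lt ?_ huW)
  nlinarith [le_abs_self Q, norm_nonneg (f - u)]

/-! ### The generalized backward shift -/

theorem apply_eq_of_mem_span {V W : Type*} [AddCommGroup V] [Module ℂ V] [AddCommGroup W]
    [Module ℂ W] {BV : SesqForm V} {BW : SesqForm W} {s : Set (V × W)}
    (hs : ∀ r ∈ s, ∀ t ∈ s, BV r.1 t.1 = BW r.2 t.2) :
    ∀ r ∈ Submodule.span ℂ s, ∀ t ∈ Submodule.span ℂ s, BV r.1 t.1 = BW r.2 t.2 := by
  intro r hr t ht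
  induction hr using Submodule.span_induction with
  | mem r hr =>
    induction ht using Submodule.span_induction with
    | mem t ht => exact hs r hr t ht
    | zero => simp
    | add t u _ _ ht hu => simp [ht, hu]
    | smul c t _ ht => simp [ht]
  | zero => simp
  | add r u _ _ hr hu => simp [hr, hu]
  | smul c r _ hr => simp [hr]

section BackwardShift

variable {C D : Type*} [NormedAddCommGroup C] [NormedSpace ℂ C]
  [NormedAddCommGroup D] [NormedSpace ℂ D] {BC : SesqForm C} {BD : SesqForm D} {k : ℕ}

/-- The generalized backward shift `f ↦ (A f - A(α) f(α)) / b`, where `b(α) = 0`, acts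
contractively on the space with kernel `(I - S(z) S(w)*) / (A(z) A(w)* - b(z) b(w)*)`. -/
theorem exists_backward_shift (hC : IsTopPontryagin BC k) (hD : IsTopPontryagin BD k)
    {X : Type*} [TopologicalSpace X] {K : X → X → C →L[ℂ] C} {P : Submodule ℂ (X → C)}
    {BP : SesqForm P} (hP : IsReproducingKernelPontryagin BC K P BP) (A b : X → ℂ)
    (T : X → C → D)
    (hK : ∀ z w c d, (A z * starRingEnd ℂ (A w) - b z * starRingEnd ℂ (b w)) * BC (K z w c) d
      = BC c d - BD (T w c) (T z d))
    (hcont : ∀ f ∈ P, Continuous f) (hdense : Dense {x | b x ≠ 0}) {α : X} (hα : b α = 0)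
    (f : P) :
    ∃ g : P, (∀ z, b z • (g : X → C) z = A z • (f : X → C) z - A α • (f : X → C) α) ∧
      (BP g g).re + ‖A α‖ ^ 2 * (BC ((f : X → C) α) ((f : X → C) α)).re ≤ (BP f f).re := by
  obtain ⟨hBP, Pp, Pm, hPd⟩ := hP.pontryagin
  obtain ⟨Cp, Cm, hCd, hCk, -⟩ := hC.exists_equivalent
  obtain ⟨Dp, Dm, hDd, hDk, -⟩ := hD.exists_equivalent
  have := hPd.finiteDimensional
  have := hCd.finiteDimensional
  have := hDd.finiteDimensional
  let κ : X → C → P := fun w c => ⟨fun z => K z w c, hP.kernel_mem w c⟩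
  have hrep : ∀ (g : P) w c, BP g (κ w c) = BC ((g : X → C) w) c := hP.reproducing
  have hrep' : ∀ (g : P) w c, BP (κ w c) g = BC c ((g : X → C) w) := fun g w c => by
    rw [hBP g, hrep, ← hC.1]
  -- `hK` with the negative terms moved across: b(z) conj(b(w)) [K c, d] + [c, d] = A(z) conj(A(w))
  -- [K c, d] + [T_w c, T_z d]. This is isometry on the generators.
  let gen : X × C → (P × C) × (P × D) := fun q =>
    ((starRingEnd ℂ (b q.1) • κ q.1 q.2, q.2), (starRingEnd ℂ (A q.1) • κ q.1 q.2, T q.1 q.2))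
  have hgen : ∀ q, gen q ∈ Submodule.span ℂ (Set.range gen) :=
    fun q => Submodule.subset_span ⟨q, rfl⟩
  obtain ⟨⟨g, c⟩, hgc, hle⟩ := exists_adjoint_of_isometric_relation (hBP.prod hC.1)
    (hBP.prod hD.1) (hPd.prod hCd) (hPd.prod hDd)
    (by rw [finrank_submodule_prod, finrank_submodule_prod, hCk, hDk])
    (Submodule.span ℂ (Set.range gen))
    (apply_eq_of_mem_span (by
      rintro _ ⟨⟨w, c⟩, rfl⟩ _ ⟨⟨z, d⟩, rfl⟩
      have h1 := hK z w c d
      have h2 : BP (κ w c) (κ z d) = BC (K z w c) d := hrep _ _ _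
      simp only [gen, prodForm_apply, map_smul, map_smulₛₗ, LinearMap.smul_apply, smul_eq_mul,
        Complex.conj_conj, h2]
      linear_combination -h1))
    (by
      rintro ⟨g, d⟩ hgd
      have hw : ∀ w c, starRingEnd ℂ (b w) * BC c ((g : X → C) w) + BC c d = 0 := fun w c => by
        have := hgd _ (hgen (w, c))
        simpa only [gen, prodForm_apply, map_smul, LinearMap.smul_apply, smul_eq_mul, hrep']
          using this
      -- At α the factor b vanishes and isolates d; afterwards g vanishes wherever b does not, hence
      -- everywhere by continuity.
      have hd : d = 0 := hC.ext_right fun c => by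
        have := hw α c
        rw [hα, map_zero, zero_mul, zero_add] at this
        rw [this, map_zero]
      have hg : (g : X → C) = 0 := by
        refine Continuous.ext_on hdense (hcont g g.2) continuous_const fun w hwb => ?_
        refine hC.ext_right fun c => ?_
        have := hw w c
        rw [hd, map_zero, add_zero] at this
        have hne : starRingEnd ℂ (b w) ≠ 0 := (map_ne_zero _).2 hwb
        rw [(mul_eq_zero.1 this).resolve_left hne]
        simp
      have hg' : g = 0 := Subtype.ext hg
      rw [hd, hg']
      rfl)
    -- The zero component removes T from the adjoint relation, leaving b g + c = A f.
    (f, (0 : D))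
  have hw : ∀ w, b w • (g : X → C) w + c = A w • (f : X → C) w := fun w =>
    hC.ext_right fun d => by
      have := hgc _ (hgen (w, d))
      simp only [gen, prodForm_apply, map_smul, LinearMap.smul_apply, smul_eq_mul, hrep',
        map_zero, add_zero] at this
      rw [map_add, map_smulₛₗ, map_smulₛₗ, smul_eq_mul, smul_eq_mul, this]
  have hc : c = A α • (f : X → C) α := by
    rw [← hw α, hα, zero_smul, zero_add]
  refine ⟨g, fun z => by rw [← hw z, ← hc, add_sub_cancel_right], ?_⟩
  simp only [prodForm_apply, hc, map_zero, add_zero, Complex.add_re, re_smul_self] at hle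
  exact hle

end BackwardShift

/-! ### Zeros of the denominator and the limit values -/

theorem neBot_nhdsNE_subtype {U : Set ℂ} (hU : IsOpen U) (z : U) : (𝓝[≠] z).NeBot := by
  have h := hU.isOpenEmbedding_subtypeVal.map_nhdsWithin_preimage_eq {(z : ℂ)}ᶜ z
  rw [show Subtype.val ⁻¹' {(z : ℂ)}ᶜ = ({z}ᶜ : Set U) by ext; simp [Subtype.ext_iff]] at h
  have : (map Subtype.val (𝓝[≠] z)).NeBot := h ▸ inferInstance
  exact this.of_map

theorem tendsto_val_nhdsNE {U : Set ℂ} (z : U) :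
    Tendsto (Subtype.val : U → ℂ) (𝓝[≠] z) (𝓝[≠] (z : ℂ)) :=
  tendsto_nhdsWithin_of_tendsto_nhds_of_eventually_within _
    (continuous_subtype_val.continuousAt.tendsto.mono_left nhdsWithin_le_nhds)
    (eventually_nhdsWithin_of_forall fun _ hy h => hy (Subtype.ext h))

/-- Off the zeros one divides; at a zero the quotient agrees with h on a punctured neighbourhood,
and h is continuous. -/
theorem resolventLike_eq {C : Type*} [NormedAddCommGroup C] [NormedSpace ℂ C] {a b : ℂ → ℂ}
    {U : Set ℂ} (hU : IsOpen U) {α : U} {f h : U → C} (hh : Continuous h)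
    (hfh : ∀ z : U, (a α * b z - b α * a z) • h z = a z • f z - a α • f α)
    (hzero : ∀ z : U, ∀ᶠ y : U in 𝓝[≠] z, a α * b y - b α * a y ≠ 0) :
    resolventLike a b α f = h := by
  have key : ∀ z : U, a α * b z - b α * a z ≠ 0 → resolventQuotient a b α f z = h z := by
    intro z hz
    rw [resolventQuotient, ← hfh, inv_smul_smul₀ hz]
  funext z
  rw [resolventLike]
  split_ifs with hz
  · have := neBot_nhdsNE_subtype hU z
    refine Tendsto.limUnder_eq ?_
    refine ((hh.tendsto z).mono_left nhdsWithin_le_nhds).congr' ?_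
    filter_upwards [hzero z] with y hy using (key y hy).symm
  · exact key z hz

theorem rhoKernel_ne_zero {Ω : Set ℂ} {a b : ℂ → ℂ} {z w : ℂ} (hz : z ∈ omegaPlus Ω a b)
    (hw : w ∈ omegaPlus Ω a b) : rhoKernel a b z w ≠ 0 := by
  rw [rhoKernel, sub_ne_zero]
  intro h
  have h1 := congrArg norm h
  rw [norm_mul, norm_mul, RCLike.norm_conj, RCLike.norm_conj] at h1
  exact (mul_lt_mul'' hz.2 hw.2 (norm_nonneg _) (norm_nonneg _)).ne' h1

/-- The zeros of `a(α) b - b(α) a` are isolated. -/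
theorem eventually_denominator_ne_zero {Ω : Set ℂ} (hΩc : IsConnected Ω) {a b : ℂ → ℂ}
    (ha : AnalyticOnNhd ℂ a Ω) (hb : AnalyticOnNhd ℂ b Ω) (hminus : (omegaMinus Ω a b).Nonempty)
    {α z : ℂ} (hα : α ∈ omegaPlus Ω a b) (hz : z ∈ Ω) :
    ∀ᶠ y in 𝓝[≠] z, a α * b y - b α * a y ≠ 0 := by
  by_contra hcon
  -- If zeros accumulated, the identity theorem would give a(α) b = b(α) a throughout Ω,
  -- contradicting |a(α) b(w)| > |b(α) a(w)| at a point w of Ω₋.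
  have hana : AnalyticOnNhd ℂ (fun y => a α * b y - b α * a y) Ω :=
    (analyticOnNhd_const.mul hb).sub (analyticOnNhd_const.mul ha)
  have h0 := hana.eqOn_zero_of_preconnected_of_frequently_eq_zero hΩc.isPreconnected hz (by
    exact fun h => hcon h)
  obtain ⟨w, hw, hlt⟩ := hminus
  have h1 := congrArg norm (sub_eq_zero.1 (h0 hw))
  rw [norm_mul, norm_mul] at h1
  exact (mul_lt_mul'' hα.2 hlt (norm_nonneg _) (norm_nonneg _)).ne' h1

/-! ### Schur kernels -/

section Schur

variable {C D : Type*} [NormedAddCommGroup C] [NormedSpace ℂ C]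
  [NormedAddCommGroup D] [NormedSpace ℂ D] {BC : SesqForm C} {BD : SesqForm D} {k l : ℕ}

theorem rhoKernel_mul_schurKernel (hC : IsTopPontryagin BC k) (hD : IsTopPontryagin BD l)
    {a b : ℂ → ℂ} {U : Set ℂ} {S : ℂ → D →L[ℂ] C} {z w : U} (hρ : rhoKernel a b z w ≠ 0)
    (c d : C) :
    rhoKernel a b z w * BC (schurKernel BC BD a b U S z w c) d
      = BC c d - BD (pontryaginAdjoint BC BD (S w) c) (pontryaginAdjoint BC BD (S z) d) := by
  rw [← hC.apply_adjoint hD]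
  simp [schurKernel, mul_inv_cancel_left₀ hρ]

/-- The elements of the space with a Schur kernel are continuous. -/
theorem continuous_of_mem_schur (hC : IsTopPontryagin BC k) (hD : IsTopPontryagin BD l)
    {a b : ℂ → ℂ} {U : Set ℂ} {S : ℂ → D →L[ℂ] C} (ha : ContinuousOn a U)
    (hb : ContinuousOn b U) (hS : ContinuousOn S U)
    (hρ : ∀ z w : U, rhoKernel a b z w ≠ 0) {P : Submodule ℂ (U → C)} {BP : SesqForm P}
    (hP : IsReproducingKernelPontryagin BC (schurKernel BC BD a b U S) P BP) :
    ∀ f ∈ P, Continuous f := by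
  obtain ⟨hBP, Pp, Pm, hPd⟩ := hP.pontryagin
  have ha' : Continuous fun z : U => a z := ha.domRestrict
  have hb' : Continuous fun z : U => b z := hb.domRestrict
  have hS' : Continuous fun z : U => S z := hS.domRestrict
  obtain ⟨M₁, hM₁, hbC⟩ := hC.exists_norm_apply_le
  obtain ⟨M₂, hM₂, hbD⟩ := hD.exists_norm_apply_le
  obtain ⟨M₃, hM₃, hadj⟩ := hC.exists_norm_adjoint_le hD
  intro f hf
  refine hPd.continuous_of_reproducing hBP hC
    (fun x => (LinearMap.proj x).comp P.subtype)
    (fun w c => ⟨fun z => schurKernel BC BD a b U S z w c, hP.kernel_mem w c⟩)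
    (fun f x c => hP.reproducing f x c)
    (fun f h => Subtype.ext (funext h)) ?_ ?_ ⟨f, hf⟩
  · intro w c
    change Continuous fun x : U => (rhoKernel a b x w)⁻¹ •
      (c - S x (pontryaginAdjoint BC BD (S w) c))
    exact (((ha'.mul continuous_const).sub (hb'.mul continuous_const)).inv₀ fun x => hρ x w).smul
      (continuous_const.sub (hS'.clm_apply continuous_const))
  · intro x₀
    let β : U → ℝ := fun x => ‖rhoKernel a b x x‖⁻¹ * (M₁ + M₂ * (M₃ * ‖S x‖) ^ 2)
    have hβ : Continuous β :=
      (((ha'.mul ha'.star).sub (hb'.mul hb'.star)).norm.inv₀ fun x =>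
        norm_ne_zero_iff.2 (hρ x x)).mul
      (continuous_const.add (continuous_const.mul ((continuous_const.mul hS'.norm).pow 2)))
    refine ⟨β x₀ + 1, ?_⟩
    filter_upwards [hβ.continuousAt.eventually_lt continuousAt_const (lt_add_one (β x₀))]
      with x hx c
    change (BC (schurKernel BC BD a b U S x x c) c).re ≤ _
    have h1 := congrArg norm (rhoKernel_mul_schurKernel hC hD (S := S) (hρ x x) c c)
    rw [norm_mul] at h1
    have h2 : ‖pontryaginAdjoint BC BD (S x) c‖ ≤ M₃ * ‖S x‖ * ‖c‖ :=
      hadj _ _ _ fun d => hC.apply_adjoint hD _ d c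
    have h3 : ‖BC (schurKernel BC BD a b U S x x c) c‖ ≤ β x * ‖c‖ ^ 2 := by
      have hpos : 0 < ‖rhoKernel a b x x‖ := norm_pos_iff.2 (hρ x x)
      simp only [β]
      rw [mul_assoc, ← div_eq_inv_mul, le_div_iff₀ hpos, mul_comm, h1]
      refine (norm_sub_le _ _).trans ?_
      calc _ ≤ M₁ * ‖c‖ * ‖c‖ + M₂ * (M₃ * ‖S x‖ * ‖c‖) * (M₃ * ‖S x‖ * ‖c‖) := by
            refine add_le_add (hbC c c) ((hbD _ _).trans ?_)
            gcongr
        _ = _ := by ring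
    refine (Complex.re_le_norm _).trans (h3.trans ?_)
    gcongr

end Schur

/-! ### The inequality for the resolvent-like operators -/

theorem proposition3p3
    {C D : Type*} [NormedAddCommGroup C] [NormedSpace ℂ C]
    [NormedAddCommGroup D] [NormedSpace ℂ D]
    (BC : SesqForm C) (BD : SesqForm D) (k : ℕ)
    (hC : IsTopPontryagin BC k) (hD : IsTopPontryagin BD k)
    (Ω : Set ℂ) (hΩ : IsOpen Ω) (hΩc : IsConnected Ω)
    (a b : ℂ → ℂ) (ha : AnalyticOnNhd ℂ a Ω) (hb : AnalyticOnNhd ℂ b Ω)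
    (hplus : (omegaPlus Ω a b).Nonempty) (hminus : (omegaMinus Ω a b).Nonempty)
    (U : Set ℂ) (hU : IsOpen U) (hUΩ : U ⊆ omegaPlus Ω a b)
    (S : ℂ → D →L[ℂ] C) (hS : IsGeneralizedSchur BC BD a b U S)
    (P : Submodule ℂ (U → C)) (BP : SesqForm P)
    (hP : IsReproducingKernelPontryagin BC (schurKernel BC BD a b U S) P BP)
    (α : U) :
    ∃ (hab : ∀ f ∈ P, resolventLike a b α f ∈ P) (hba : ∀ f ∈ P, resolventLike b a α f ∈ P),
      ∀ (f : U → C) (hf : f ∈ P),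
        (BP ⟨resolventLike a b α f, hab f hf⟩ ⟨resolventLike a b α f, hab f hf⟩).re
          - (BP ⟨resolventLike b a α f, hba f hf⟩ ⟨resolventLike b a α f, hba f hf⟩).re
          + (BC (f α) (f α)).re ≤ 0 := by
  have hBP := hP.pontryagin.1
  have hUO : U ⊆ Ω := fun z hz => (hUΩ hz).1
  have hρ : ∀ z w : U, rhoKernel a b z w ≠ 0 := fun z w =>
    rhoKernel_ne_zero (hUΩ z.2) (hUΩ w.2)
  have hcont := continuous_of_mem_schur hC hD (ha.continuousOn.mono hUO)
    (hb.continuousOn.mono hUO) hS.1.continuousOn hρ hP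
  have hzero : ∀ z : U, ∀ᶠ y : U in 𝓝[≠] z, a α * b y - b α * a y ≠ 0 := fun z =>
    (tendsto_val_nhdsNE z).eventually
      (eventually_denominator_ne_zero hΩc ha hb hminus (hUΩ α.2) (hUO z.2))
  have hzero' : ∀ z : U, ∀ᶠ y : U in 𝓝[≠] z, b α * a y - a α * b y ≠ 0 := fun z => by
    filter_upwards [hzero z] with y hy
    rw [← neg_sub]
    exact neg_ne_zero.2 hy
  let ρ : ℝ := ‖a α‖ ^ 2 - ‖b α‖ ^ 2
  have hρ0 : 0 < ρ := sub_pos.2 (pow_lt_pow_left₀ (hUΩ α.2).2 (norm_nonneg _) two_ne_zero)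
  have hρC : (ρ : ℂ) = a α * starRingEnd ℂ (a α) - b α * starRingEnd ℂ (b α) := by
    simp [ρ, Complex.mul_conj']
  let r : ℝ := Real.sqrt ρ
  have hr0 : (r : ℂ) ≠ 0 := Complex.ofReal_ne_zero.2 (Real.sqrt_pos.2 hρ0).ne'
  have hr2 : (r : ℂ) * r = ρ := by rw [← Complex.ofReal_mul, Real.mul_self_sqrt hρ0.le]
  have hρ1 : (ρ : ℂ) ≠ 0 := Complex.ofReal_ne_zero.2 hρ0.ne'
  -- Division by r = √ρ normalizes this hyperbolic rotation to determinant one, so that it preserves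
  -- ρ(z, w).
  let A : U → ℂ := fun z => (starRingEnd ℂ (a α) * a z - starRingEnd ℂ (b α) * b z) / r
  let β : U → ℂ := fun z => (a α * b z - b α * a z) / r
  have hA : A α = r := by
    simp only [A]
    rw [div_eq_iff hr0, hr2, hρC]
    ring
  have hβα : β α = 0 := by
    simp only [β]
    rw [mul_comm, sub_self, zero_div]
  have hkey : ∀ z w : U, A z * starRingEnd ℂ (A w) - β z * starRingEnd ℂ (β w)
      = rhoKernel a b z w := by
    intro z w
    simp only [A, β, rhoKernel, map_div₀, map_sub, map_mul, Complex.conj_conj, Complex.conj_ofReal]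
    rw [div_mul_div_comm, div_mul_div_comm, hr2, ← sub_div, div_eq_iff hρ1, hρC]
    ring
  have hdense : Dense {x : U | β x ≠ 0} := by
    intro z
    have := neBot_nhdsNE_subtype hU z
    refine mem_closure_iff_frequently.2 ?_
    have h1 : ∃ᶠ y in 𝓝[≠] z, β y ≠ 0 :=
      ((hzero z).mono fun y hy => div_ne_zero hy hr0).frequently
    exact h1.filter_mono nhdsWithin_le_nhds
  -- Inverting the rotation, a = (a(α) A + conj(b(α)) β)/r and b = (b(α) A + conj(a(α)) β)/r.
  -- Substituting β g = A f - r f(α) gives both formulas; the minus sign is that of the exchanged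
  -- denominator.
  have hshift : ∀ f : P, ∃ g : P, resolventLike a b α f
        = (((ρ : ℂ)⁻¹ • (a α • g + starRingEnd ℂ (b α) • f) : P) : U → C) ∧
      resolventLike b a α f
        = ((-(ρ : ℂ)⁻¹ • (b α • g + starRingEnd ℂ (a α) • f) : P) : U → C) ∧
      (BP g g).re + ρ * (BC ((f : U → C) α) ((f : U → C) α)).re ≤ (BP f f).re := by
    intro f
    obtain ⟨g, hg, hle⟩ := exists_backward_shift hC hD hP A β
      (fun w c => pontryaginAdjoint BC BD (S w) c)
      (fun z w c d => by rw [hkey, rhoKernel_mul_schurKernel hC hD (hρ z w)])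
      hcont hdense hβα f
    have hAα : ‖A α‖ ^ 2 = ρ := by
      rw [hA, Complex.norm_real, Real.norm_eq_abs, sq_abs, Real.sq_sqrt hρ0.le]
    rw [hAα] at hle
    have hfg : ∀ z : U, (a α * b z - b α * a z) • (g : U → C) z =
        (starRingEnd ℂ (a α) * a z - starRingEnd ℂ (b α) * b z) • (f : U → C) z
          - (ρ : ℂ) • (f : U → C) α := by
      intro z
      have h1 := congrArg (fun v => (r : ℂ) • v) (hg z)
      simp only [smul_sub, smul_smul, hA, hr2, A, β, mul_div_cancel₀ _ hr0] at h1
      exact h1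
    refine ⟨g, resolventLike_eq hU (hcont _ (Subtype.mem _)) (fun z => ?_) hzero,
      resolventLike_eq hU (hcont _ (Subtype.mem _)) (fun z => ?_) hzero', hle⟩
    · have h1 := hfg z
      simp only [Submodule.coe_smul, Submodule.coe_add, Pi.smul_apply, Pi.add_apply]
      rw [smul_comm, inv_smul_eq_iff₀ hρ1, smul_add, smul_comm _ (a α), h1, hρC]
      module
    · have h1 := hfg z
      simp only [Submodule.coe_smul, Submodule.coe_add, Pi.smul_apply, Pi.add_apply]
      rw [neg_smul, smul_neg, ← neg_smul, neg_sub, smul_comm, inv_smul_eq_iff₀ hρ1, smul_add,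
        smul_comm _ (b α), h1, hρC]
      module
  refine ⟨fun f hf => ?_, fun f hf => ?_, fun f hf => ?_⟩
  · obtain ⟨g, h1, -, -⟩ := hshift ⟨f, hf⟩
    exact h1 ▸ Subtype.mem _
  · obtain ⟨g, -, h2, -⟩ := hshift ⟨f, hf⟩
    exact h2 ▸ Subtype.mem _
  · obtain ⟨g, h1, h2, hle⟩ := hshift ⟨f, hf⟩
    have e1 : ∀ h, (⟨resolventLike a b α f, h⟩ : P) =
        (ρ : ℂ)⁻¹ • (a α • g + starRingEnd ℂ (b α) • ⟨f, hf⟩) := fun _ => Subtype.ext h1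
    have e2 : ∀ h, (⟨resolventLike b a α f, h⟩ : P) =
        -(ρ : ℂ)⁻¹ • (b α • g + starRingEnd ℂ (a α) • ⟨f, hf⟩) := fun _ => Subtype.ext h2
    rw [e1, e2, re_smul_self, re_smul_self, hBP.re_add_self, hBP.re_add_self, re_smul_self,
      re_smul_self, re_smul_self, re_smul_self]
    -- Both cross terms equal a(α) b(α) [g, f], so they cancel in the difference.
    have hx : BP (a α • g) (starRingEnd ℂ (b α) • ⟨f, hf⟩) =
        BP (b α • g) (starRingEnd ℂ (a α) • ⟨f, hf⟩) := by
      simp only [map_smul, map_smulₛₗ, LinearMap.smul_apply, smul_eq_mul, Complex.conj_conj]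
      ring
    have hn : ‖-(ρ : ℂ)⁻¹‖ = ρ⁻¹ := by
      rw [norm_neg, norm_inv, Complex.norm_real, Real.norm_eq_abs, abs_of_pos hρ0]
    have hn' : ‖(ρ : ℂ)⁻¹‖ = ρ⁻¹ := by rw [← norm_neg, hn]
    rw [hx, hn, hn', RCLike.norm_conj, RCLike.norm_conj]
    set G := (BP g g).re
    set F := (BP (⟨f, hf⟩ : P) ⟨f, hf⟩).re
    change G + ρ * (BC (f α) (f α)).re ≤ F at hle
    have hsum : ∀ t : ℝ, ρ⁻¹ ^ 2 * (‖a α‖ ^ 2 * G + 2 * t + ‖b α‖ ^ 2 * F)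
        - ρ⁻¹ ^ 2 * (‖b α‖ ^ 2 * G + 2 * t + ‖a α‖ ^ 2 * F) + (BC (f α) (f α)).re
        = ρ⁻¹ * (G + ρ * (BC (f α) (f α)).re - F) := by
      intro t
      have : ‖a α‖ ^ 2 = ρ + ‖b α‖ ^ 2 := by simp [ρ]
      rw [this]
      field_simp
      ring
    rw [hsum]
    exact mul_nonpos_of_nonneg_of_nonpos (inv_nonneg.2 hρ0.le) (by linarith)
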